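/- Let $d\ge 3$ be an integer, let $n>d$ and $\alpha$ be real numbers, and let $p$ be a positive function in $C^3(\mathbb S^{d-1})$. Let $g$, $\nabla$, $\Delta$ and $d\omega$ denote the standard metric of $\mathbb S^{d-1}$, the gradient (covariant derivative), the Laplace–Beltrami operator and the uniform measure on $\mathbb S^{d-1}$, and set $$\mathrm L p:=(\nabla\otimes\nabla)p-\tfrac1{d-1}(\Delta p)\,g,\qquad \mathrm M p:=\frac{\nabla p\otimes\nabla p}{p}-\frac1{d-1}\frac{|\nabla p|^2}{p}\,g,\qquad \alpha_{\rm FS}:=\sqrt{\frac{d-1}{n-1}}.$$ Then all the integrals below converge, and $$\int_{\mathbb S^{d-1}}\Big[\tfrac12\Delta|\nabla p|^2-\nabla p\cdot\nabla\Delta p-\tfrac1{n-1}(\Delta p)^2-(n-2)\,\alpha^2|\nabla p|^2\Big]p^{1-n}\,d\omega$$ $$=\frac{(n-2)(d-1)}{(n-1)(d-2)}\int_{\mathbb S^{d-1}}\Big\|\mathrm L p-\frac{3(n-1)(n-d)}{2(n-2)(d+1)}\,\mathrm M p\Big\|^2p^{1-n}\,d\omega$$ $$+\frac{n-d}{2(d+1)}\Big[\frac{n+3}2+\frac{3(n-1)(n+1)(d-2)}{2(n-2)(d+1)}\Big]\int_{\mathbb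 S^{d-1}}\frac{|\nabla p|^4}{p^2}\,p^{1-n}\,d\omega+(n-2)\big[\alpha_{\rm FS}^2-\alpha^2\big]\int_{\mathbb S^{d-1}}|\nabla p|^2\,p^{1-n}\,d\omega ,$$ where $\|\cdot\|$ is the Hilbert–Schmidt norm of $2$-tensors with respect to $g$. The coefficients of the first two integrals on the right-hand side are positive. If, in addition, $0\le\alpha\le\alpha_{\rm FS}$, then all three terms of the right-hand side are non-negative. -/

import Mathlib

open Metric MeasureTheory
open scoped Manifold ContDiff Gradient

noncomputable section

/-- The Euclidean space `ℝ^d`. -/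
abbrev Rd (d : ℕ) := EuclideanSpace ℝ (Fin d)

/-- The unit sphere `𝕊^{d-1}` of `ℝ^d`, with the metric induced by `ℝ^d`. -/
abbrev Sph (d : ℕ) := sphere (0 : Rd d) 1

theorem fact_finrank_Rd {d : ℕ} (hd : 1 ≤ d) :
    Fact (Module.finrank ℝ (Rd d) = (d - 1) + 1) :=
  ⟨by rw [finrank_euclideanSpace_fin]; omega⟩

/-- `f ∈ C^k(𝕊^{d-1})`, for the smooth manifold structure of the sphere in Mathlib. -/
def SphContDiff {d : ℕ} (hd : 1 ≤ d) (k : ℕ∞) (f : Sph d → ℝ) : Prop :=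
  haveI := fact_finrank_Rd hd
  ContMDiff (𝓡 (d - 1)) 𝓘(ℝ, ℝ) (k : WithTop ℕ∞) f

/-- The extension of a function on the sphere to `ℝ^d \ {0}` that is constant along rays,
`x ↦ f (x / |x|)`, with value `0` at the origin. Its derivative at a point of the sphere, in a
tangent direction, is the derivative of `f` in that direction; in the normal direction it is `0`. -/
def radialExt {d : ℕ} {F : Type*} [Zero F] (f : Sph d → F) (x : Rd d) : F :=
  if hx : x = 0 then 0
  else f ⟨‖x‖⁻¹ • x, by
    rw [mem_sphere_zero_iff_norm, norm_smul, norm_inv, norm_norm,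
      inv_mul_cancel₀ (norm_ne_zero_iff.mpr hx)]⟩

/-- The tangent space of the sphere at `x`, i.e. the orthogonal complement of `x` in `ℝ^d`,
with the induced inner product. -/
abbrev TanSph {d : ℕ} (x : Sph d) : Submodule ℝ (Rd d) := (ℝ ∙ (x : Rd d))ᗮ

/-- The gradient `∇f` on the sphere, as a tangent vector field with values in `ℝ^d`. -/
def sphGrad {d : ℕ} (f : Sph d → ℝ) (x : Sph d) : Rd d :=
  ∇ (radialExt f) (x : Rd d)

/-- Covariant `2`-tensors on the tangent space of the sphere at `x`. -/
abbrev TwoTensor {d : ℕ} (x : Sph d) := LinearMap.BilinForm ℝ (TanSph x)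

/-- The standard metric `g` of the sphere at `x`. -/
def sphMetric {d : ℕ} (x : Sph d) : TwoTensor x := innerₗ (TanSph x)

/-- The Hessian `(∇ ⊗ ∇) f` at `x`: `(X, Y) ↦ ⟨D_X (∇f), Y⟩` for tangent vectors `X`, `Y`.
This is `⟨∇_X ∇f, Y⟩` for the Levi-Civita connection of the induced metric, the tangential
part of the derivative in `ℝ^d`. -/
def sphHess {d : ℕ} (f : Sph d → ℝ) (x : Sph d) : TwoTensor x :=
  (innerₗ (Rd d)).compl₁₂
    ((fderiv ℝ (radialExt (sphGrad f)) (x : Rd d)).toLinearMap ∘ₗ (TanSph x).subtype)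
    (TanSph x).subtype

/-- The trace of a `2`-tensor with respect to the metric, in an orthonormal basis. -/
def tensorTrace {d : ℕ} {x : Sph d} (A : TwoTensor x) : ℝ :=
  ∑ i, A (stdOrthonormalBasis ℝ (TanSph x) i) (stdOrthonormalBasis ℝ (TanSph x) i)

/-- The square `‖A‖²` of the norm of a `2`-tensor: the sum of the squares of its coefficients in an
orthonormal basis. -/
def tensorNormSq {d : ℕ} {x : Sph d} (A : TwoTensor x) : ℝ :=
  ∑ i, ∑ j, A (stdOrthonormalBasis ℝ (TanSph x) i) (stdOrthonormalBasis ℝ (TanSph x) j) ^ 2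

/-- The Laplace-Beltrami operator of the sphere: the trace of the Hessian. -/
def sphLaplacian {d : ℕ} (f : Sph d → ℝ) (x : Sph d) : ℝ := tensorTrace (sphHess f x)

/-- `∇f ⊗ ∇f` at `x`, as the bilinear form `(X, Y) ↦ ⟨∇f, X⟩ ⟨∇f, Y⟩`. -/
def gradTensorGrad {d : ℕ} (f : Sph d → ℝ) (x : Sph d) : TwoTensor x :=
  LinearMap.BilinForm.linMulLin
    (innerₗ (Rd d) (sphGrad f x) ∘ₗ (TanSph x).subtype)
    (innerₗ (Rd d) (sphGrad f x) ∘ₗ (TanSph x).subtype)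

/-- The trace-free Hessian `L f = (∇ ⊗ ∇) f - (Δ f) g / (d - 1)`. -/
def tensorL {d : ℕ} (f : Sph d → ℝ) (x : Sph d) : TwoTensor x :=
  sphHess f x - (1 / ((d : ℝ) - 1) * sphLaplacian f x) • sphMetric x

/-- `M f = (∇f ⊗ ∇f) / f - (|∇f|² / f) g / (d - 1)`. -/
def tensorM {d : ℕ} (f : Sph d → ℝ) (x : Sph d) : TwoTensor x :=
  (f x)⁻¹ • gradTensorGrad f x
    - (1 / ((d : ℝ) - 1) * (‖sphGrad f x‖ ^ 2 / f x)) • sphMetric x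

/-- `½ Δ|∇f|² - ∇f · ∇Δf - (Δf)² / (n - 1) - (n - 2) α² |∇f|²`. -/
def angularTerm {d : ℕ} (n α : ℝ) (f : Sph d → ℝ) (x : Sph d) : ℝ :=
  1 / 2 * sphLaplacian (fun y => ‖sphGrad f y‖ ^ 2) x
    - inner ℝ (sphGrad f x) (sphGrad (sphLaplacian f) x)
    - 1 / (n - 1) * sphLaplacian f x ^ 2
    - (n - 2) * α ^ 2 * ‖sphGrad f x‖ ^ 2

/-- The Felli-Schneider threshold `α_FS = √((d - 1) / (n - 1))`. -/
def alphaFS (d : ℕ) (n : ℝ) : ℝ := √(((d : ℝ) - 1) / (n - 1))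

/-- The uniform (surface) measure `dω` on the sphere. -/
def sphMeasure (d : ℕ) : Measure (Sph d) := (volume : Measure (Rd d)).toSphere

/-- The coefficient of `M p` inside the square. -/
def coeffM (d : ℕ) (n : ℝ) : ℝ :=
  3 * (n - 1) * (n - d) / (2 * (n - 2) * ((d : ℝ) + 1))

/-- The coefficient of the integral of the square. -/
def coeffSq (d : ℕ) (n : ℝ) : ℝ :=
  (n - 2) * ((d : ℝ) - 1) / ((n - 1) * ((d : ℝ) - 2))

/-- The coefficient of the integral of the fourth power of the gradient. -/
def coeffGrad4 (d : ℕ) (n : ℝ) : ℝ :=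
  (n - d) / (2 * ((d : ℝ) + 1)) *
    ((n + 3) / 2
      + 3 * (n - 1) * (n + 1) * ((d : ℝ) - 2) / (2 * (n - 2) * ((d : ℝ) + 1)))

end

/-! Extend `p` to `ℝ^d \ {0}` constantly along rays. The extension is homogeneous of degree 0 and
its partial derivatives are homogeneous of degree -1, so Euler's identity controls every normal
derivative. On the sphere, gradient, Hessian and Laplacian become Euclidean derivatives of the
extension, up to explicit normal corrections.

Two facts carry the proof. `bochner_sphere` turns `½Δ|∇p|² - ∇p·∇Δp` into `‖Hess p‖² + (d-2)|∇p|²`.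
`integral_mul_sphLaplacian` is Green's formula, applied with three weights. Write `H, L, A, B, Q, G`
for the integrals against `p^(1-n)` of `‖Hess p‖²`, `(Δp)²`, `Hess p(∇p,∇p)/p`, `Δp|∇p|²/p`,
`|∇p|⁴/p²`, `|∇p|²`. Green and Bochner give `B = nQ - 2A` and `H = (n-1)A - (n-1)B + L - (d-2)G`.

Expanding `‖Lp - c Mp‖²` (`tensorNormSq_sub_smul`) then makes both sides linear in `L, A, Q, G`. The
coefficient of `L` forces `coeffSq`, that of `A` forces `c = coeffM`, that of `G` produces `α_FS²`,
and what remains of `Q` is `coeffGrad4`. -/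

noncomputable section

/-! ### Radial extensions and their regularity. -/

/-- The `i`-th partial derivative of a function on `ℝ^d`. -/
def partialD {d : ℕ} (i : Fin d) (f : Rd d → ℝ) (x : Rd d) : ℝ :=
  fderiv ℝ f x (EuclideanSpace.single i 1)

theorem radialExt_coe {d : ℕ} {F : Type*} [Zero F] (f : Sph d → F) (x : Sph d) :
    radialExt f x = f x := by
  have hx : (x : Rd d) ≠ 0 := ne_zero_of_mem_unit_sphere x
  have h1 : ‖(x : Rd d)‖ = 1 := norm_eq_of_mem_sphere x
  unfold radialExt
  rw [dif_neg hx]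
  congr 1
  ext1
  simp [h1]

theorem radialExt_smul {d : ℕ} {F : Type*} [Zero F] (f : Sph d → F) {t : ℝ} (ht : 0 < t)
    (x : Rd d) : radialExt f (t • x) = radialExt f x := by
  unfold radialExt
  by_cases hx : x = 0
  · simp [hx]
  rw [dif_neg hx, dif_neg (by simp [hx, ht.ne'])]
  congr 1
  ext1
  simp only [norm_smul, Real.norm_eq_abs, abs_of_pos ht, smul_smul]
  congr 1
  field_simp

theorem radialExt_of_ne_zero {d : ℕ} {F : Type*} [Zero F] {f : Sph d → F} {g : Rd d → F}
    (h : ∀ y : Sph d, f y = g y) {x : Rd d} (hx : x ≠ 0) :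
    radialExt f x = g (‖x‖⁻¹ • x) := by
  unfold radialExt
  rw [dif_neg hx, h]

theorem contDiffOn_normalize {d : ℕ} {k : WithTop ℕ∞} :
    ContDiffOn ℝ k (fun x : Rd d => ‖x‖⁻¹ • x) {0}ᶜ := fun _ hx =>
  (((contDiffAt_norm ℝ hx).inv (norm_ne_zero_iff.2 hx)).smul contDiffAt_id).contDiffWithinAt

/-- The only passage from manifold regularity to Euclidean regularity: the extension is `f` composed
with the smooth map `x ↦ x/|x|` from the open set `{0}ᶜ` to the sphere. -/
theorem contDiffOn_radialExt {d : ℕ} (hd : 1 ≤ d) {k : ℕ∞} {f : Sph d → ℝ}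
    (hf : SphContDiff hd k f) : ContDiffOn ℝ k (radialExt f) {0}ᶜ := by
  have := fact_finrank_Rd hd
  unfold SphContDiff at hf
  let U : TopologicalSpace.Opens (Rd d) := ⟨{0}ᶜ, isOpen_compl_singleton⟩
  have hN : ContMDiff 𝓘(ℝ, Rd d) 𝓘(ℝ, Rd d) (k : WithTop ℕ∞)
      (fun x : U => ‖(x : Rd d)‖⁻¹ • (x : Rd d)) := fun x =>
    (contMDiffAt_subtype_iff (f := fun x : Rd d => ‖x‖⁻¹ • x)).2
      (contDiffOn_normalize.contDiffAt (isOpen_compl_singleton.mem_nhds x.2)).contMDiffAt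
  have hmem : ∀ x : U, ‖(x : Rd d)‖⁻¹ • (x : Rd d) ∈ sphere (0 : Rd d) 1 := fun x => by
    have : (x : Rd d) ≠ 0 := x.2
    simp [norm_smul, this]
  have hc := hf.comp (hN.codRestrict_sphere hmem)
  intro x hx
  apply ContDiffAt.contDiffWithinAt
  rw [← contMDiffAt_iff_contDiffAt]
  refine (contMDiffAt_subtype_iff (U := U) (x := ⟨x, hx⟩)).1 ?_
  refine (hc.contMDiffAt).congr_of_eventuallyEq (Filter.Eventually.of_forall fun y => ?_)
  have : (y : Rd d) ≠ 0 := y.2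
  simp only [radialExt, dif_neg this]
  rfl

theorem continuous_of_contDiffOn_radialExt {d : ℕ} {k : WithTop ℕ∞} {f : Sph d → ℝ}
    (hf : ContDiffOn ℝ k (radialExt f) {0}ᶜ) : Continuous f := by
  have := hf.continuousOn.comp_continuous (f := fun x : Sph d => (x : Rd d)) continuous_subtype_val
    (fun x => ne_zero_of_mem_unit_sphere x)
  simpa only [Function.comp_def, radialExt_coe] using this

/-- A function which is the restriction to the sphere of a `C^k` function on `ℝ^d \ {0}` has a
radial extension of class `C^k`. -/
theorem contDiffOn_radialExt_of_restrict {d : ℕ} {k : WithTop ℕ∞} {f : Sph d → ℝ} {g : Rd d → ℝ}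
    (hg : ContDiffOn ℝ k g {0}ᶜ) (h : ∀ y : Sph d, f y = g y) :
    ContDiffOn ℝ k (radialExt f) {0}ᶜ := by
  refine (hg.comp contDiffOn_normalize fun x hx => ?_).congr fun _ hx => radialExt_of_ne_zero h hx
  have hx' : x ≠ 0 := hx
  simp [hx']

/-! ### Partial derivatives on `ℝ^d \ {0}` and homogeneous functions. -/

section PartialDerivatives

variable {d : ℕ} {f g : Rd d → ℝ} {x : Rd d}

theorem partialD_congr (i : Fin d) (h : ∀ y : Rd d, y ≠ 0 → f y = g y) (hx : x ≠ 0) :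
    partialD i f x = partialD i g x := by
  unfold partialD
  rw [Filter.EventuallyEq.fderiv_eq]
  filter_upwards [isOpen_compl_singleton.mem_nhds hx] with y hy using h y hy

theorem partialD_add (i : Fin d) (hf : DifferentiableAt ℝ f x) (hg : DifferentiableAt ℝ g x) :
    partialD i (fun y => f y + g y) x = partialD i f x + partialD i g x := by
  simp [partialD, fderiv_fun_add hf hg]

theorem partialD_mul (i : Fin d) (hf : DifferentiableAt ℝ f x) (hg : DifferentiableAt ℝ g x) :
    partialD i (fun y => f y * g y) x = partialD i f x * g x + f x * partialD i g x := by
  simp [partialD, fderiv_fun_mul hf hg]; ring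

theorem partialD_const_mul (i : Fin d) (c : ℝ) (hf : DifferentiableAt ℝ f x) :
    partialD i (fun y => c * f y) x = c * partialD i f x := by
  simp [partialD, fderiv_const_mul hf]

theorem partialD_sq (i : Fin d) (hf : DifferentiableAt ℝ f x) :
    partialD i (fun y => f y ^ 2) x = 2 * (f x * partialD i f x) := by
  simp only [pow_two]
  rw [partialD_mul i hf hf]
  ring

theorem partialD_sum {ι : Type*} {s : Finset ι} (i : Fin d) {F : ι → Rd d → ℝ}
    (hF : ∀ j ∈ s, DifferentiableAt ℝ (F j) x) :
    partialD i (fun y => ∑ j ∈ s, F j y) x = ∑ j ∈ s, partialD i (F j) x := by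
  simp [partialD, fderiv_fun_sum hF]

theorem partialD_comp (i : Fin d) {φ : ℝ → ℝ} {φ' : ℝ} (hφ : HasDerivAt φ φ' (f x))
    (hf : DifferentiableAt ℝ f x) : partialD i (fun y => φ (f y)) x = φ' * partialD i f x := by
  have := (hφ.comp_hasFDerivAt x hf.hasFDerivAt).fderiv
  simp only [Function.comp_def] at this
  simp [partialD, this]

theorem partialD_norm_sq (i : Fin d) (x : Rd d) :
    partialD i (fun y => ‖y‖ ^ 2) x = 2 * x i := by
  simp [partialD, fderiv_norm_sq_apply, EuclideanSpace.inner_single_right]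

theorem partialD_coord (i j : Fin d) (x : Rd d) :
    partialD i (fun y => y j) x = if j = i then 1 else 0 := by
  have : HasFDerivAt (fun y : Rd d => y j) (EuclideanSpace.proj j : Rd d →L[ℝ] ℝ) x :=
    (EuclideanSpace.proj j : Rd d →L[ℝ] ℝ).hasFDerivAt
  simp [partialD, this.fderiv]

theorem fderiv_eq_sum_partialD (f : Rd d → ℝ) (x X : Rd d) :
    fderiv ℝ f x X = ∑ i, X i * partialD i f x := by
  conv_lhs => rw [← (EuclideanSpace.basisFun (Fin d) ℝ).sum_repr X]
  simp [partialD]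

theorem contDiffOn_partialD {k m : WithTop ℕ∞} (i : Fin d) (hf : ContDiffOn ℝ m f {0}ᶜ)
    (hk : k + 1 ≤ m) : ContDiffOn ℝ k (partialD i f) {0}ᶜ :=
  (hf.fderiv_of_isOpen isOpen_compl_singleton hk).clm_apply contDiffOn_const

theorem ContDiffOn.differentiableAt_of_ne_zero {m : WithTop ℕ∞} (hf : ContDiffOn ℝ m f {0}ᶜ)
    (hm : m ≠ 0) (hx : x ≠ 0) : DifferentiableAt ℝ f x :=
  (hf.contDiffAt (isOpen_compl_singleton.mem_nhds hx)).differentiableAt hm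

theorem partialD_comm {m : WithTop ℕ∞} (hf : ContDiffOn ℝ m f {0}ᶜ) (hm : 2 ≤ m) (hx : x ≠ 0)
    (i j : Fin d) : partialD i (partialD j f) x = partialD j (partialD i f) x := by
  have hc : ContDiffAt ℝ m f x := hf.contDiffAt (isOpen_compl_singleton.mem_nhds hx)
  have hs : IsSymmSndFDerivAt ℝ f x := hc.isSymmSndFDerivAt (by simpa using hm)
  have hd : DifferentiableAt ℝ (fderiv ℝ f) x :=
    (hc.fderiv_right (m := 1) (by simpa [one_add_one_eq_two] using hm)).differentiableAt one_ne_zero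
  have key : ∀ i j : Fin d, partialD i (partialD j f) x =
      fderiv ℝ (fderiv ℝ f) x (EuclideanSpace.single i 1) (EuclideanSpace.single j 1) := by
    intro i j
    have : partialD j f = fun y => fderiv ℝ f y (EuclideanSpace.single j 1) := rfl
    rw [this, partialD, fderiv_clm_apply hd (differentiableAt_const _)]
    simp
  rw [key, key, hs.eq]

/-- Differentiate `f(tx) = t^m f(x)` in `x`. Differentiability is not needed, because both sides of
the chain rule for a dilation take the default value together. -/
theorem partialD_smul_of_homogeneous {m : ℤ} (hf : ∀ t : ℝ, 0 < t → ∀ x, f (t • x) = t ^ m * f x)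
    (i : Fin d) {t : ℝ} (ht : 0 < t) (x : Rd d) :
    partialD i f (t • x) = t ^ (m - 1) * partialD i f x := by
  have h1 := fderiv_comp_smul (𝕜 := ℝ) (f := f) (x := x) t
  have h2 : (fun x => f (t • x)) = fun x => (t ^ m) • f x := by
    ext y; simp [hf t ht]
  have h3 : fderiv ℝ (fun x => (t ^ m) • f x) x = (t ^ m) • fderiv ℝ f x := by
    exact congrFun (fderiv_const_smul_field (t ^ m)) x
  rw [h2, h3] at h1
  have h4 := congrArg (fun T : Rd d →L[ℝ] ℝ => T (EuclideanSpace.single i 1)) h1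
  simp only [smul_apply, smul_eq_mul] at h4
  unfold partialD
  rw [zpow_sub_one₀ ht.ne']
  field_simp
  linarith

/-- Euler's identity for homogeneous functions. -/
theorem sum_mul_partialD_of_homogeneous {m : ℤ}
    (hf : ∀ t : ℝ, 0 < t → ∀ x, f (t • x) = t ^ m * f x) (hx : DifferentiableAt ℝ f x) :
    ∑ i, x i * partialD i f x = m * f x := by
  rw [← fderiv_eq_sum_partialD]
  have h1 : HasDerivAt (fun t : ℝ => f (t • x)) (fderiv ℝ f x x) 1 := by
    have hx' : HasFDerivAt f (fderiv ℝ f x) ((1 : ℝ) • x) := by simpa using hx.hasFDerivAt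
    have := hx'.comp_hasDerivAt (1 : ℝ) ((hasDerivAt_id (1 : ℝ)).smul_const x)
    simpa [Function.comp_def] using this
  have h2 : HasDerivAt (fun t : ℝ => t ^ m * f x) (m * f x) 1 := by
    have := (hasDerivAt_zpow m (1 : ℝ) (Or.inl one_ne_zero)).mul_const (f x)
    simpa using this
  refine h1.unique (h2.congr_of_eventuallyEq ?_)
  filter_upwards [lt_mem_nhds (show (0 : ℝ) < 1 by norm_num)] with t ht using hf t ht x

end PartialDerivatives

/-! ### Gradient, Hessian and Laplacian read off the radial extension. -/

section SphereCalculus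

variable {d : ℕ} {f g : Sph d → ℝ} {x : Sph d}

theorem sphGrad_apply (f : Sph d → ℝ) (x : Sph d) (i : Fin d) :
    sphGrad f x i = partialD i (radialExt f) x := by
  have h : inner ℝ (sphGrad f x) (EuclideanSpace.single i (1 : ℝ)) =
      partialD i (radialExt f) x := by
    rw [sphGrad, gradient, InnerProductSpace.toDual_symm_apply]; rfl
  rw [← h]
  simp [EuclideanSpace.inner_single_right]

theorem inner_sphGrad (f g : Sph d → ℝ) (x : Sph d) :
    inner ℝ (sphGrad f x) (sphGrad g x) =
      ∑ i, partialD i (radialExt f) x * partialD i (radialExt g) x := by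
  simp [PiLp.inner_apply, sphGrad_apply, mul_comm]

theorem norm_sphGrad_sq (f : Sph d → ℝ) (x : Sph d) :
    ‖sphGrad f x‖ ^ 2 = ∑ i, partialD i (radialExt f) x ^ 2 := by
  rw [← real_inner_self_eq_norm_sq, inner_sphGrad]
  simp [pow_two]

theorem partialD_radialExt_smul (f : Sph d → ℝ) (i : Fin d) {t : ℝ} (ht : 0 < t) (y : Rd d) :
    partialD i (radialExt f) (t • y) = t⁻¹ * partialD i (radialExt f) y := by
  have := partialD_smul_of_homogeneous (f := radialExt f) (m := 0)
    (fun t ht x => by simp [radialExt_smul f ht x]) i ht y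
  simpa using this

theorem partialD_partialD_radialExt_smul (f : Sph d → ℝ) (i j : Fin d) {t : ℝ} (ht : 0 < t)
    (y : Rd d) : partialD i (partialD j (radialExt f)) (t • y) =
      (t ^ 2)⁻¹ * partialD i (partialD j (radialExt f)) y := by
  have := partialD_smul_of_homogeneous (f := partialD j (radialExt f)) (m := -1)
    (fun t ht x => by simp [partialD_radialExt_smul f j ht x]) i ht y
  rw [this]
  norm_num [zpow_neg]

theorem sum_mul_partialD_radialExt {k : WithTop ℕ∞} (hf : ContDiffOn ℝ k (radialExt f) {0}ᶜ)
    (hk : 1 ≤ k) {y : Rd d} (hy : y ≠ 0) : ∑ i, y i * partialD i (radialExt f) y = 0 := by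
  have := sum_mul_partialD_of_homogeneous (f := radialExt f) (m := 0)
    (fun t ht x => by simp [radialExt_smul f ht x])
    (hf.differentiableAt_of_ne_zero (one_pos.trans_le hk).ne' hy)
  simpa using this

theorem sum_mul_partialD_partialD_radialExt {k : WithTop ℕ∞}
    (hf : ContDiffOn ℝ k (radialExt f) {0}ᶜ) (hk : 2 ≤ k) {y : Rd d} (hy : y ≠ 0) (j : Fin d) :
    ∑ i, y i * partialD i (partialD j (radialExt f)) y = -partialD j (radialExt f) y := by
  have := sum_mul_partialD_of_homogeneous (f := partialD j (radialExt f)) (m := -1)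
    (fun t ht x => by simp [partialD_radialExt_smul f j ht x])
    ((contDiffOn_partialD (k := 1) j hf
      (by simpa [one_add_one_eq_two] using hk)).differentiableAt_of_ne_zero one_ne_zero hy)
  simpa using this

theorem inner_coe_sphGrad (hf : ContDiffOn ℝ 1 (radialExt f) {0}ᶜ) :
    inner ℝ (x : Rd d) (sphGrad f x) = 0 := by
  rw [← sum_mul_partialD_radialExt hf le_rfl (ne_zero_of_mem_unit_sphere x)]
  simp [PiLp.inner_apply, sphGrad_apply, mul_comm]

theorem sphGrad_mem_tanSph (hf : ContDiffOn ℝ 1 (radialExt f) {0}ᶜ) : sphGrad f x ∈ TanSph x :=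
  Submodule.mem_orthogonal_singleton_iff_inner_right.2 (inner_coe_sphGrad hf)

/-- The second derivative of the radial extension of `f` at `x`, as a bilinear form on `ℝ^d`. -/
def hessForm (f : Sph d → ℝ) (x : Sph d) : LinearMap.BilinForm ℝ (Rd d) :=
  (innerₗ (Rd d)).compl₁₂ (fderiv ℝ (∇ (radialExt f)) (x : Rd d)).toLinearMap LinearMap.id

theorem gradient_apply (F : Rd d → ℝ) (y : Rd d) (j : Fin d) : ∇ F y j = partialD j F y := by
  have h : inner ℝ (∇ F y) (EuclideanSpace.single j (1 : ℝ)) = partialD j F y := by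
    rw [gradient, InnerProductSpace.toDual_symm_apply]; rfl
  rw [← h, EuclideanSpace.inner_single_right]
  simp

theorem differentiableAt_gradient {k : WithTop ℕ∞} {F : Rd d → ℝ} (hF : ContDiffOn ℝ k F {0}ᶜ)
    (hk : 2 ≤ k) {y : Rd d} (hy : y ≠ 0) : DifferentiableAt ℝ (∇ F) y := by
  have : DifferentiableAt ℝ (fderiv ℝ F) y :=
    ((hF.contDiffAt (isOpen_compl_singleton.mem_nhds hy)).fderiv_right (m := 1)
      (by simpa [one_add_one_eq_two] using hk)).differentiableAt one_ne_zero
  exact (InnerProductSpace.toDual ℝ (Rd d)).symm.toContinuousLinearEquiv.differentiableAt.comp y this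

theorem hessForm_apply {k : WithTop ℕ∞} (hf : ContDiffOn ℝ k (radialExt f) {0}ᶜ) (hk : 2 ≤ k)
    (X Y : Rd d) : hessForm f x X Y =
      ∑ i, ∑ j, X i * Y j * partialD i (partialD j (radialExt f)) x := by
  have hD := differentiableAt_gradient hf hk (ne_zero_of_mem_unit_sphere x)
  have hj : ∀ j, fderiv ℝ (∇ (radialExt f)) (x : Rd d) X j =
      ∑ i, X i * partialD i (partialD j (radialExt f)) x := by
    intro j
    rw [← fderiv_eq_sum_partialD]
    have h := ((EuclideanSpace.proj j : Rd d →L[ℝ] ℝ).hasFDerivAt.comp (x : Rd d)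
      hD.hasFDerivAt).fderiv
    have h' : ((EuclideanSpace.proj j : Rd d →L[ℝ] ℝ) ∘ ∇ (radialExt f)) =
        partialD j (radialExt f) := by
      ext y; simp [gradient_apply]
    rw [h'] at h
    rw [h]; rfl
  simp only [hessForm, LinearMap.compl₁₂_apply, ContinuousLinearMap.coe_coe, LinearMap.id_apply,
    innerₗ_apply_apply, PiLp.inner_apply, hj, RCLike.inner_apply, conj_trivial]
  rw [Finset.sum_comm]
  refine Finset.sum_congr rfl fun j _ => ?_
  rw [Finset.mul_sum]
  exact Finset.sum_congr rfl fun i _ => by ring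

/-- Euler's identity in degree -1. The mixed normal-tangential part of the Euclidean Hessian is thus
`-∇f`, not zero; this is the source of the correction in `tensorNormSq_sphHess`. -/
theorem hessForm_coe_left {k : WithTop ℕ∞} (hf : ContDiffOn ℝ k (radialExt f) {0}ᶜ) (hk : 2 ≤ k)
    (Y : Rd d) : hessForm f x x Y = -inner ℝ (sphGrad f x) Y := by
  rw [hessForm_apply hf hk, Finset.sum_comm]
  simp only [PiLp.inner_apply, sphGrad_apply, ← Finset.sum_neg_distrib]
  refine Finset.sum_congr rfl fun j _ => ?_
  have := sum_mul_partialD_partialD_radialExt hf hk (ne_zero_of_mem_unit_sphere x) j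
  simp only [RCLike.inner_apply, conj_trivial]
  rw [← mul_neg, ← this, Finset.mul_sum]
  exact Finset.sum_congr rfl fun i _ => by ring

theorem hessForm_comm {k : WithTop ℕ∞} (hf : ContDiffOn ℝ k (radialExt f) {0}ᶜ) (hk : 2 ≤ k)
    (X Y : Rd d) : hessForm f x X Y = hessForm f x Y X := by
  rw [hessForm_apply hf hk, hessForm_apply hf hk, Finset.sum_comm]
  refine Finset.sum_congr rfl fun j _ => Finset.sum_congr rfl fun i _ => ?_
  rw [partialD_comm hf hk (ne_zero_of_mem_unit_sphere x)]
  ring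

theorem radialExt_sphGrad (f : Sph d → ℝ) {y : Rd d} (hy : y ≠ 0) :
    radialExt (sphGrad f) y = ‖y‖ • ∇ (radialExt f) y := by
  have h := radialExt_of_ne_zero (f := sphGrad f) (g := ∇ (radialExt f)) (fun _ => rfl) hy
  rw [h]
  ext i
  have : 0 < ‖y‖⁻¹ := inv_pos.2 (norm_pos_iff.2 hy)
  simp [gradient_apply, partialD_radialExt_smul f i this]

theorem hasFDerivAt_norm_coe (x : Sph d) :
    HasFDerivAt (fun y : Rd d => ‖y‖) (innerSL ℝ (x : Rd d)) (x : Rd d) := by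
  have h1 : ‖(x : Rd d)‖ = 1 := norm_eq_of_mem_sphere x
  have h := (hasStrictFDerivAt_norm_sq (x : Rd d)).hasFDerivAt.sqrt (by simp [h1])
  simp only [Real.sqrt_sq (norm_nonneg _)] at h
  have e : (1 / (2 * ‖(x : Rd d)‖)) • 2 • innerSL ℝ (x : Rd d) = innerSL ℝ (x : Rd d) := by
    ext v
    simp [h1]
  rwa [e] at h

/-- The extended field `radialExt (sphGrad f)` is `|y| ∇(radialExt f)`, and the derivative of `|y|`
at `x` vanishes in tangent directions. -/
theorem sphHess_apply {k : WithTop ℕ∞} (hf : ContDiffOn ℝ k (radialExt f) {0}ᶜ) (hk : 2 ≤ k)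
    (X Y : TanSph x) : sphHess f x X Y = hessForm f x X Y := by
  have hx := ne_zero_of_mem_unit_sphere x
  have hD := differentiableAt_gradient hf hk hx
  have h1 : ‖(x : Rd d)‖ = 1 := norm_eq_of_mem_sphere x
  have h := (hasFDerivAt_norm_coe x).smul hD.hasFDerivAt
  have h2 : fderiv ℝ (radialExt (sphGrad f)) (x : Rd d) = _ :=
    Filter.EventuallyEq.fderiv_eq (by
      filter_upwards [isOpen_compl_singleton.mem_nhds hx] with y hy using radialExt_sphGrad f hy)
  have hX : inner ℝ (x : Rd d) (X : Rd d) = 0 :=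
    Submodule.mem_orthogonal_singleton_iff_inner_right.1 X.2
  change inner ℝ (fderiv ℝ (radialExt (sphGrad f)) (x : Rd d) X) (Y : Rd d) =
    inner ℝ (fderiv ℝ (∇ (radialExt f)) (x : Rd d) X) (Y : Rd d)
  rw [h2]
  erw [h.fderiv]
  simp [h1, hX]

/-- The trace of a bilinear form over the tangent space of the sphere. -/
theorem sum_tanSph_basis {ι : Type*} [Fintype ι] (b : OrthonormalBasis ι ℝ (TanSph x))
    (B : LinearMap.BilinForm ℝ (Rd d)) :
    ∑ k, B (b k) (b k) =
      ∑ i, B (EuclideanSpace.single i 1) (EuclideanSpace.single i 1) - B x x := by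
  have h1 : ‖(x : Rd d)‖ = 1 := norm_eq_of_mem_sphere x
  have hdec : ∀ v : Rd d, v = ∑ k, inner ℝ (b k : Rd d) v • (b k : Rd d) +
      inner ℝ (x : Rd d) v • (x : Rd d) := by
    intro v
    have hw : v - inner ℝ (x : Rd d) v • (x : Rd d) ∈ TanSph x := by
      rw [Submodule.mem_orthogonal_singleton_iff_inner_right]
      simp [inner_sub_right, inner_smul_right, h1]
    have hs := congrArg (Subtype.val) (b.sum_repr' ⟨_, hw⟩)
    simp only [Submodule.coe_sum, Submodule.coe_smul, Submodule.coe_inner] at hs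
    have hb : ∀ k, inner ℝ (b k : Rd d) (x : Rd d) = 0 := fun k =>
      Submodule.mem_orthogonal_singleton_iff_inner_left.1 (b k).2
    simp only [inner_sub_right, inner_smul_right, hb, mul_zero, sub_zero] at hs
    rw [hs]; abel
  have hexp : ∀ v : Rd d, ∑ i, v i • EuclideanSpace.single i (1 : ℝ) = v := fun v => by
    simpa using (EuclideanSpace.basisFun (Fin d) ℝ).sum_repr v
  have key : ∀ i, B (EuclideanSpace.single i 1) (EuclideanSpace.single i 1) =
      ∑ k, (b k : Rd d) i * B (EuclideanSpace.single i 1) (b k) +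
        (x : Rd d) i * B (EuclideanSpace.single i 1) x := by
    intro i
    conv_lhs => arg 2; rw [hdec (EuclideanSpace.single i 1)]
    simp [EuclideanSpace.inner_single_right]
  have hB : ∀ v w : Rd d, ∑ i, v i * B (EuclideanSpace.single i 1) w = B v w := by
    intro v w
    conv_rhs => rw [← hexp v]
    simp
  simp_rw [key, Finset.sum_add_distrib]
  rw [Finset.sum_comm, hB]
  simp_rw [hB]
  ring

/-- The trace formula is applied in each slot separately, to squares of linear forms. -/
theorem sum_sq_tanSph_basis {ι : Type*} [Fintype ι] (b : OrthonormalBasis ι ℝ (TanSph x))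
    (B : LinearMap.BilinForm ℝ (Rd d)) :
    ∑ k, ∑ l, B (b k) (b l) ^ 2 =
      ∑ i, ∑ j, B (EuclideanSpace.single i 1) (EuclideanSpace.single j 1) ^ 2
        - ∑ j, B x (EuclideanSpace.single j 1) ^ 2 - ∑ i, B (EuclideanSpace.single i 1) x ^ 2
        + B x x ^ 2 := by
  have h1 : ∀ v, ∑ l, B v (b l) ^ 2 =
      ∑ j, B v (EuclideanSpace.single j 1) ^ 2 - B v x ^ 2 := fun v => by
    simpa [pow_two] using sum_tanSph_basis b (LinearMap.BilinForm.linMulLin (B v) (B v))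
  have h2 : ∀ v, ∑ k, B (b k) v ^ 2 =
      ∑ j, B (EuclideanSpace.single j 1) v ^ 2 - B x v ^ 2 := fun v => by
    simpa [pow_two] using sum_tanSph_basis b (LinearMap.BilinForm.linMulLin (B.flip v) (B.flip v))
  simp_rw [h1, Finset.sum_sub_distrib]
  rw [Finset.sum_comm]
  simp_rw [h2, Finset.sum_sub_distrib]
  rw [Finset.sum_comm]
  ring

theorem hessForm_single {k : WithTop ℕ∞} (hf : ContDiffOn ℝ k (radialExt f) {0}ᶜ) (hk : 2 ≤ k)
    (i j : Fin d) : hessForm f x (EuclideanSpace.single i 1) (EuclideanSpace.single j 1) =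
      partialD i (partialD j (radialExt f)) x := by
  rw [hessForm_apply hf hk]
  simp

theorem sphLaplacian_eq {k : WithTop ℕ∞} (hf : ContDiffOn ℝ k (radialExt f) {0}ᶜ) (hk : 2 ≤ k) :
    sphLaplacian f x = ∑ i, partialD i (partialD i (radialExt f)) x := by
  simp only [sphLaplacian, tensorTrace, sphHess_apply hf hk]
  rw [sum_tanSph_basis, hessForm_coe_left hf hk, real_inner_comm,
    inner_coe_sphGrad (hf.of_le (one_le_two.trans hk))]
  simp [hessForm_single hf hk]

/-- The row and the column of the normal vector each contribute `|∇f|²` to the Euclidean sum of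
squares, and their common entry is 0 since `∇f` is tangent. -/
theorem tensorNormSq_sphHess {k : WithTop ℕ∞} (hf : ContDiffOn ℝ k (radialExt f) {0}ᶜ)
    (hk : 2 ≤ k) : tensorNormSq (sphHess f x) =
      ∑ i, ∑ j, partialD i (partialD j (radialExt f)) x ^ 2 - 2 * ‖sphGrad f x‖ ^ 2 := by
  simp only [tensorNormSq, sphHess_apply hf hk]
  rw [sum_sq_tanSph_basis]
  simp_rw [hessForm_comm hf hk _ (x : Rd d), hessForm_single hf hk, hessForm_coe_left hf hk]
  rw [real_inner_comm, inner_coe_sphGrad (hf.of_le (one_le_two.trans hk)), norm_sphGrad_sq]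
  simp only [EuclideanSpace.inner_single_right, conj_trivial, sphGrad_apply, one_mul, neg_sq]
  ring

end SphereCalculus

/-! ### Leibniz and chain rules, and the Bochner formula. -/

section SphereIdentities

variable {d : ℕ} {f g : Sph d → ℝ} {x : Sph d}

theorem radialExt_mul (f g : Sph d → ℝ) (y : Rd d) :
    radialExt (fun z => f z * g z) y = radialExt f y * radialExt g y := by
  unfold radialExt
  split_ifs <;> simp

theorem radialExt_comp (φ : ℝ → ℝ) (f : Sph d → ℝ) {y : Rd d} (hy : y ≠ 0) :
    radialExt (fun z => φ (f z)) y = φ (radialExt f y) := by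
  simp [radialExt, hy]

theorem ContDiffOn.radialExt_mul {k : WithTop ℕ∞} (hf : ContDiffOn ℝ k (radialExt f) {0}ᶜ)
    (hg : ContDiffOn ℝ k (radialExt g) {0}ᶜ) :
    ContDiffOn ℝ k (radialExt (fun z => f z * g z)) {0}ᶜ :=
  (hf.mul hg).congr fun y _ => _root_.radialExt_mul f g y

theorem contDiffOn_radialExt_rpow {k : WithTop ℕ∞} (hf : ContDiffOn ℝ k (radialExt f) {0}ᶜ)
    (hpos : ∀ x, 0 < f x) (s : ℝ) : ContDiffOn ℝ k (radialExt (fun z => f z ^ s)) {0}ᶜ := by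
  refine (hf.rpow_const_of_ne (p := s) fun y hy => ?_).congr
    fun y hy => radialExt_comp (fun t => t ^ s) f hy
  have hy' : y ≠ 0 := hy
  simpa [radialExt, hy'] using (hpos _).ne'

theorem sphGrad_mul (hf : ContDiffOn ℝ 1 (radialExt f) {0}ᶜ)
    (hg : ContDiffOn ℝ 1 (radialExt g) {0}ᶜ) :
    sphGrad (fun z => f z * g z) x = f x • sphGrad g x + g x • sphGrad f x := by
  have hx := ne_zero_of_mem_unit_sphere x
  ext i
  rw [sphGrad_apply, partialD_congr i (fun y _ => radialExt_mul f g y) hx,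
    partialD_mul i (hf.differentiableAt_of_ne_zero one_ne_zero hx)
      (hg.differentiableAt_of_ne_zero one_ne_zero hx)]
  simp [sphGrad_apply, radialExt_coe]
  ring

theorem sphGrad_comp {φ : ℝ → ℝ} {φ' : ℝ} (hf : ContDiffOn ℝ 1 (radialExt f) {0}ᶜ)
    (hφ : HasDerivAt φ φ' (f x)) : sphGrad (fun z => φ (f z)) x = φ' • sphGrad f x := by
  have hx := ne_zero_of_mem_unit_sphere x
  ext i
  rw [sphGrad_apply, partialD_congr i (fun y hy => radialExt_comp φ f hy) hx,
    partialD_comp (φ' := φ') i (by rwa [radialExt_coe])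
      (hf.differentiableAt_of_ne_zero one_ne_zero hx)]
  simp [sphGrad_apply]

theorem radialExt_norm_sphGrad_sq (f : Sph d → ℝ) {y : Rd d} (hy : y ≠ 0) :
    radialExt (fun z => ‖sphGrad f z‖ ^ 2) y = ‖y‖ ^ 2 * ∑ i, partialD i (radialExt f) y ^ 2 := by
  have h := radialExt_of_ne_zero (f := fun z => ‖sphGrad f z‖ ^ 2)
    (g := fun y => ∑ i, partialD i (radialExt f) y ^ 2) (norm_sphGrad_sq f) hy
  rw [h]
  have : 0 < ‖y‖⁻¹ := inv_pos.2 (norm_pos_iff.2 hy)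
  simp [partialD_radialExt_smul f _ this, mul_pow, Finset.mul_sum]

theorem radialExt_sphLaplacian {k : WithTop ℕ∞} (hf : ContDiffOn ℝ k (radialExt f) {0}ᶜ)
    (hk : 2 ≤ k) {y : Rd d} (hy : y ≠ 0) :
    radialExt (sphLaplacian f) y =
      ‖y‖ ^ 2 * ∑ i, partialD i (partialD i (radialExt f)) y := by
  have h := radialExt_of_ne_zero (f := sphLaplacian f)
    (g := fun y => ∑ i, partialD i (partialD i (radialExt f)) y)
    (fun _ => sphLaplacian_eq hf hk) hy
  rw [h]
  have : 0 < ‖y‖⁻¹ := inv_pos.2 (norm_pos_iff.2 hy)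
  simp [partialD_partialD_radialExt_smul f _ _ this, Finset.mul_sum]

theorem contDiffOn_radialExt_inner_sphGrad {k m : WithTop ℕ∞}
    (hf : ContDiffOn ℝ m (radialExt f) {0}ᶜ) (hg : ContDiffOn ℝ m (radialExt g) {0}ᶜ)
    (hk : k + 1 ≤ m) :
    ContDiffOn ℝ k (radialExt (fun z => inner ℝ (sphGrad f z) (sphGrad g z))) {0}ᶜ :=
  contDiffOn_radialExt_of_restrict
    (ContDiffOn.sum fun i _ => (contDiffOn_partialD i hf hk).mul (contDiffOn_partialD i hg hk))
    (inner_sphGrad f g)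

theorem contDiffOn_radialExt_norm_sphGrad_sq {k m : WithTop ℕ∞}
    (hf : ContDiffOn ℝ m (radialExt f) {0}ᶜ) (hk : k + 1 ≤ m) :
    ContDiffOn ℝ k (radialExt (fun z => ‖sphGrad f z‖ ^ 2)) {0}ᶜ := by
  simpa only [real_inner_self_eq_norm_sq] using contDiffOn_radialExt_inner_sphGrad hf hf hk

theorem contDiffOn_radialExt_sphLaplacian {k l m : WithTop ℕ∞}
    (hf : ContDiffOn ℝ m (radialExt f) {0}ᶜ) (hl : l + 1 ≤ m) (hk : k + 1 ≤ l) (hm : 2 ≤ m) :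
    ContDiffOn ℝ k (radialExt (sphLaplacian f)) {0}ᶜ :=
  contDiffOn_radialExt_of_restrict
    (g := fun y => ∑ i, partialD i (partialD i (radialExt f)) y)
    (ContDiffOn.sum fun i _ => contDiffOn_partialD i (contDiffOn_partialD i hf hl) hk)
    (fun _ => sphLaplacian_eq hf hm)

theorem differentiableAt_coord (j : Fin d) (y : Rd d) :
    DifferentiableAt ℝ (fun z : Rd d => z j) y :=
  (EuclideanSpace.proj j : Rd d →L[ℝ] ℝ).differentiableAt

theorem differentiableAt_norm_sq (y : Rd d) : DifferentiableAt ℝ (fun z : Rd d => ‖z‖ ^ 2) y :=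
  differentiableAt_id.norm_sq ℝ

theorem partialD_radialExt_norm_sphGrad_sq (hf : ContDiffOn ℝ 2 (radialExt f) {0}ᶜ) (j : Fin d)
    {y : Rd d} (hy : y ≠ 0) : partialD j (radialExt (fun z => ‖sphGrad f z‖ ^ 2)) y =
      2 * y j * ∑ i, partialD i (radialExt f) y ^ 2 +
        ‖y‖ ^ 2 * ∑ i, 2 * (partialD i (radialExt f) y *
          partialD j (partialD i (radialExt f)) y) := by
  have hP : ∀ i, DifferentiableAt ℝ (partialD i (radialExt f)) y := fun i =>
    (contDiffOn_partialD (k := 1) i hf (by norm_num [one_add_one_eq_two])).differentiableAt_of_ne_zero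
      one_ne_zero hy
  rw [partialD_congr j (fun z hz => radialExt_norm_sphGrad_sq f hz) hy,
    partialD_mul j (differentiableAt_norm_sq y)
      (DifferentiableAt.fun_sum fun i _ => (hP i).fun_pow 2),
    partialD_norm_sq, partialD_sum j (fun i _ => (hP i).fun_pow 2)]
  simp_rw [partialD_sq j (hP _)]

/-- The factor `|y|²` in the extension of `|∇f|²` contributes only a normal term, orthogonal to
`∇f`. -/
theorem inner_sphGrad_norm_sphGrad_sq (hf : ContDiffOn ℝ 2 (radialExt f) {0}ᶜ) :
    inner ℝ (sphGrad f x) (sphGrad (fun z => ‖sphGrad f z‖ ^ 2) x) =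
      2 * hessForm f x (sphGrad f x) (sphGrad f x) := by
  have hx := ne_zero_of_mem_unit_sphere x
  have h1 : ‖(x : Rd d)‖ = 1 := norm_eq_of_mem_sphere x
  have hE := sum_mul_partialD_radialExt hf one_le_two hx
  rw [inner_sphGrad, hessForm_apply hf le_rfl]
  simp_rw [partialD_radialExt_norm_sphGrad_sq hf _ hx, h1, sphGrad_apply, mul_add,
    Finset.sum_add_distrib]
  have e : ∑ j, partialD j (radialExt f) x * (2 * (x : Rd d) j *
      ∑ i, partialD i (radialExt f) x ^ 2) =
      2 * (∑ i, partialD i (radialExt f) x ^ 2) *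
        ∑ j, (x : Rd d) j * partialD j (radialExt f) x := by
    rw [Finset.mul_sum]
    exact Finset.sum_congr rfl fun j _ => by ring
  rw [e, hE, mul_zero, zero_add, Finset.mul_sum]
  refine Finset.sum_congr rfl fun j _ => ?_
  simp_rw [Finset.mul_sum]
  exact Finset.sum_congr rfl fun i _ => by ring

/-- The Bochner formula on the unit sphere. -/
theorem bochner_sphere (hf : ContDiffOn ℝ 3 (radialExt f) {0}ᶜ) :
    1 / 2 * sphLaplacian (fun y => ‖sphGrad f y‖ ^ 2) x
      - inner ℝ (sphGrad f x) (sphGrad (sphLaplacian f) x) =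
    tensorNormSq (sphHess f x) + ((d : ℝ) - 2) * ‖sphGrad f x‖ ^ 2 := by
  have hx := ne_zero_of_mem_unit_sphere x
  have h1 : ‖(x : Rd d)‖ = 1 := norm_eq_of_mem_sphere x
  have h2 : ContDiffOn ℝ 2 (radialExt f) {0}ᶜ := hf.of_le (by norm_num)
  have h23 : (2 : WithTop ℕ∞) + 1 ≤ 3 := by norm_num
  have h12 : (1 : WithTop ℕ∞) + 1 ≤ 2 := by norm_num [one_add_one_eq_two]
  set P : Fin d → Rd d → ℝ := fun i => partialD i (radialExt f)
  have hP2 : ∀ i, ContDiffOn ℝ 2 (P i) {0}ᶜ := fun i => contDiffOn_partialD i hf h23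
  have hP : ∀ i, DifferentiableAt ℝ (P i) (x : Rd d) := fun i =>
    (hP2 i).differentiableAt_of_ne_zero two_ne_zero hx
  have hPP : ∀ i j, DifferentiableAt ℝ (partialD i (P j)) (x : Rd d) := fun i j =>
    (contDiffOn_partialD i (hP2 j) h12).differentiableAt_of_ne_zero one_ne_zero hx
  have hS : DifferentiableAt ℝ (fun y => ∑ i, P i y ^ 2) (x : Rd d) :=
    DifferentiableAt.fun_sum fun i _ => (hP i).fun_pow 2
  have hT : ∀ j, DifferentiableAt ℝ (fun y => ∑ i, 2 * (P i y * partialD j (P i) y)) (x : Rd d) :=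
    fun j => DifferentiableAt.fun_sum fun i _ => ((hP i).fun_mul (hPP j i)).const_mul 2
  have hgrad : ∀ j, partialD j (radialExt (sphLaplacian f)) x =
      2 * (x : Rd d) j * ∑ i, partialD i (P i) x + ∑ i, partialD i (partialD i (P j)) x := by
    intro j
    rw [partialD_congr j (fun y hy => radialExt_sphLaplacian h2 le_rfl hy) hx,
      partialD_mul j (differentiableAt_norm_sq _)
        (DifferentiableAt.fun_sum fun i _ => hPP i i),
      partialD_norm_sq, partialD_sum j (fun i _ => hPP i i), h1, one_pow, one_mul]
    congr 1
    refine Finset.sum_congr rfl fun i _ => ?_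
    rw [partialD_comm (hP2 i) le_rfl hx]
    exact partialD_congr i (fun y hy => partialD_comm h2 le_rfl hy j i) hx
  -- The coefficient 8 collects two equal cross terms, each with coefficient 4, from the product
  -- rule for `|y|² ∑ (∂ᵢf)²`.
  have hlap : ∀ j, partialD j (partialD j (radialExt (fun z => ‖sphGrad f z‖ ^ 2))) x =
      2 * ∑ i, P i x ^ 2 + 8 * ∑ i, P i x * ((x : Rd d) j * partialD j (P i) x) +
        2 * ∑ i, (partialD j (P i) x ^ 2 + P i x * partialD j (partialD j (P i)) x) := by
    intro j
    rw [partialD_congr j (fun y hy => partialD_radialExt_norm_sphGrad_sq h2 j hy) hx]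
    change partialD j (fun y => 2 * y j * ∑ i, P i y ^ 2 +
      ‖y‖ ^ 2 * ∑ i, 2 * (P i y * partialD j (P i) y)) (x : Rd d) = _
    rw [partialD_add j (((differentiableAt_coord j _).const_mul 2).fun_mul hS)
        ((differentiableAt_norm_sq _).fun_mul (hT j)),
      partialD_mul j ((differentiableAt_coord j _).const_mul 2) hS,
      partialD_mul j (differentiableAt_norm_sq _) (hT j),
      partialD_const_mul j 2 (differentiableAt_coord j _), partialD_coord, partialD_norm_sq,
      partialD_sum j (fun i _ => (hP i).fun_pow 2),
      partialD_sum j (fun i _ => ((hP i).fun_mul (hPP j i)).const_mul 2), h1]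
    simp_rw [partialD_sq j (hP _), partialD_const_mul j 2 ((hP _).fun_mul (hPP j _)),
      partialD_mul j (hP _) (hPP j _)]
    simp only [if_true, mul_one, one_pow, one_mul, Finset.mul_sum, ← Finset.sum_add_distrib]
    exact Finset.sum_congr rfl fun i _ => by ring
  rw [sphLaplacian_eq (contDiffOn_radialExt_norm_sphGrad_sq hf h23) le_rfl, inner_sphGrad,
    tensorNormSq_sphHess h2 le_rfl, norm_sphGrad_sq]
  simp_rw [hlap, hgrad]
  -- With `S = |∇f|²`, summing over `j` gives `2d S - 8 S`, hence `(d-4) S` after halving; the `2 S`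
  -- separating the Euclidean from the spherical Hessian norm turns this into `(d-2) S`. The
  -- third-order terms cancel.
  have hE := sum_mul_partialD_radialExt hf (by norm_num) hx
  have hE2 : ∑ j, ∑ i, P i x * ((x : Rd d) j * partialD j (P i) x) = -∑ i, P i x ^ 2 := by
    rw [Finset.sum_comm, ← Finset.sum_neg_distrib]
    refine Finset.sum_congr rfl fun i _ => ?_
    rw [← Finset.mul_sum, sum_mul_partialD_partialD_radialExt h2 le_rfl hx]
    simp only [P]
    ring
  have hE3 : ∑ j, P j x * (2 * (x : Rd d) j * ∑ i, partialD i (P i) x +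
      ∑ i, partialD i (partialD i (P j)) x) =
      ∑ j, ∑ i, P i x * partialD j (partialD j (P i)) x := by
    have : ∑ j, P j x * (2 * (x : Rd d) j * ∑ i, partialD i (P i) x) = 0 := by
      rw [← mul_zero (2 * ∑ i, partialD i (P i) x), ← hE, Finset.mul_sum]
      exact Finset.sum_congr rfl fun j _ => by simp only [P]; ring
    simp_rw [mul_add, Finset.sum_add_distrib]
    rw [this, zero_add, Finset.sum_comm (γ := Fin d)]
    simp_rw [Finset.mul_sum]
  simp only [P] at hE3
  rw [hE3]
  simp only [Finset.sum_add_distrib, ← Finset.mul_sum, Finset.sum_const, Finset.card_univ,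
    Fintype.card_fin, nsmul_eq_mul]
  rw [hE2]
  simp only [P]
  ring

end SphereIdentities

/-! ### Expansion of `‖Lp - c Mp‖²`. -/

/-- In an orthonormal basis `L f - c M f` is the Hessian matrix minus a rank-one matrix minus a
scalar matrix. -/
theorem sum_sq_sub_rank_one_sub_diagonal {ι : Type*} [Fintype ι] [DecidableEq ι]
    (h : ι → ι → ℝ) (u : ι → ℝ) (a s : ℝ) :
    ∑ k, ∑ l, (h k l - a * (u k * u l) - s * if k = l then 1 else 0) ^ 2 =
      ∑ k, ∑ l, h k l ^ 2 - 2 * a * ∑ k, ∑ l, u k * u l * h k l + a ^ 2 * (∑ k, u k ^ 2) ^ 2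
        - 2 * s * ∑ k, h k k + 2 * a * s * ∑ k, u k ^ 2 + s ^ 2 * Fintype.card ι := by
  have e : ∀ k l, (h k l - a * (u k * u l) - s * if k = l then 1 else 0) ^ 2 =
      h k l ^ 2 - 2 * a * (u k * u l * h k l) + a ^ 2 * (u k ^ 2 * u l ^ 2) +
        if k = l then s ^ 2 - 2 * s * h k k + 2 * a * s * u k ^ 2 else 0 := by
    intro k l
    by_cases hkl : k = l
    · subst hkl
      simp only [if_true]
      ring
    · simp only [hkl, if_false]
      ring
  have e2 : (∑ k, u k ^ 2) ^ 2 = ∑ k, ∑ l, u k ^ 2 * u l ^ 2 := by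
    rw [pow_two, Finset.sum_mul_sum]
  simp_rw [e, e2, Finset.sum_add_distrib, Finset.sum_sub_distrib]
  simp only [Finset.sum_ite_eq, Finset.mem_univ, if_true, Finset.sum_add_distrib,
    Finset.sum_sub_distrib, ← Finset.mul_sum, Finset.sum_const, Finset.card_univ, nsmul_eq_mul]
  ring

section Tensors

variable {d : ℕ} {f : Sph d → ℝ} {x : Sph d}

theorem finrank_tanSph (hd : 1 ≤ d) (x : Sph d) : Module.finrank ℝ (TanSph x) = d - 1 := by
  have := fact_finrank_Rd hd
  exact Submodule.finrank_orthogonal_span_singleton (ne_zero_of_mem_unit_sphere x)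

theorem tensorNormSq_sub_smul (hd : 3 ≤ d) (hf : ContDiffOn ℝ 2 (radialExt f) {0}ᶜ) (c : ℝ) :
    tensorNormSq (tensorL f x - c • tensorM f x) =
      tensorNormSq (sphHess f x) - sphLaplacian f x ^ 2 / ((d : ℝ) - 1)
        - 2 * c * (hessForm f x (sphGrad f x) (sphGrad f x) / f x
            - sphLaplacian f x * ‖sphGrad f x‖ ^ 2 / (f x * ((d : ℝ) - 1)))
        + c ^ 2 * (((d : ℝ) - 2) / ((d : ℝ) - 1)) * (‖sphGrad f x‖ ^ 4 / f x ^ 2) := by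
  have hf1 : ContDiffOn ℝ 1 (radialExt f) {0}ᶜ := hf.of_le one_le_two
  have hd1 : (d : ℝ) - 1 ≠ 0 := by
    have : (3 : ℝ) ≤ d := by exact_mod_cast hd
    linarith
  set b := stdOrthonormalBasis ℝ (TanSph x) with hb
  set u : Fin (Module.finrank ℝ (TanSph x)) → ℝ := fun k => inner ℝ (sphGrad f x) (b k : Rd d)
    with hu
  set s : ℝ := 1 / ((d : ℝ) - 1) * sphLaplacian f x
    - c * (1 / ((d : ℝ) - 1) * (‖sphGrad f x‖ ^ 2 / f x)) with hs
  have hentry : ∀ k l, (tensorL f x - c • tensorM f x) (b k) (b l) =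
      sphHess f x (b k) (b l) - c * (f x)⁻¹ * (u k * u l) - s * if k = l then 1 else 0 := by
    intro k l
    have hbb : inner ℝ (b k : Rd d) (b l : Rd d) = if k = l then (1 : ℝ) else 0 := by
      rw [← Submodule.coe_inner]
      exact orthonormal_iff_ite.1 b.orthonormal k l
    simp [tensorL, tensorM, sphMetric, gradTensorGrad, hbb, hu, hs]
    split_ifs <;> ring
  have hu2 : ∑ k, u k ^ 2 = ‖sphGrad f x‖ ^ 2 := by
    have := sum_tanSph_basis b (LinearMap.BilinForm.linMulLin (innerₗ (Rd d) (sphGrad f x))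
      (innerₗ (Rd d) (sphGrad f x)))
    simp only [LinearMap.BilinForm.linMulLin_apply, innerₗ_apply_apply,
      real_inner_comm (x : Rd d) (sphGrad f x)] at this
    rw [inner_coe_sphGrad hf1] at this
    rw [norm_sphGrad_sq]
    simpa [hu, pow_two, EuclideanSpace.inner_single_right, sphGrad_apply] using this
  have hutan : ∑ k, u k • b k = (⟨sphGrad f x, sphGrad_mem_tanSph hf1⟩ : TanSph x) := by
    have := b.sum_repr' ⟨sphGrad f x, sphGrad_mem_tanSph hf1⟩
    simpa [hu, real_inner_comm] using this
  have hH : ∑ k, ∑ l, u k * u l * sphHess f x (b k) (b l) =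
      hessForm f x (sphGrad f x) (sphGrad f x) := by
    have := sphHess_apply (x := x) hf le_rfl ⟨sphGrad f x, sphGrad_mem_tanSph hf1⟩
      ⟨sphGrad f x, sphGrad_mem_tanSph hf1⟩
    rw [← this, ← hutan]
    simp only [map_sum, map_smul, LinearMap.sum_apply, LinearMap.smul_apply, smul_eq_mul,
      Finset.mul_sum]
    rw [Finset.sum_comm]
    exact Finset.sum_congr rfl fun k _ => Finset.sum_congr rfl fun l _ => by ring
  have hcard : ((Fintype.card (Fin (Module.finrank ℝ (TanSph x))) : ℕ) : ℝ) = (d : ℝ) - 1 := by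
    rw [Fintype.card_fin, finrank_tanSph (by omega), Nat.cast_sub (by omega), Nat.cast_one]
  rw [tensorNormSq]
  simp_rw [← hb, hentry]
  rw [sum_sq_sub_rank_one_sub_diagonal, hH, hu2, hcard]
  change tensorNormSq (sphHess f x) - _ + _ - 2 * s * sphLaplacian f x + _ + _ = _
  rw [hs]
  -- At a zero of `f` the convention `a / 0 = 0` removes every term containing `c` on both sides, so
  -- no positivity is required.
  by_cases h0 : f x = 0
  · simp only [h0, inv_zero, div_zero, zero_mul, mul_zero]
    field_simp
    ring
  · field_simp
    ring

end Tensors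

/-! ### Polar coordinates and Green's formula on the sphere. -/

instance isFiniteMeasure_sphMeasure (d : ℕ) : IsFiniteMeasure (sphMeasure d) :=
  inferInstanceAs (IsFiniteMeasure (volume : Measure (Rd d)).toSphere)

/-- Integration in polar coordinates of a radial function times a function of the direction. -/
theorem integral_radial_mul_radialExt {d : ℕ} (a : ℝ → ℝ) (k : Sph d → ℝ) :
    ∫ x : Rd d, a ‖x‖ * radialExt k x =
      (∫ x, k x ∂sphMeasure d) *
        ∫ r : Set.Ioi (0 : ℝ), a r ∂Measure.volumeIoiPow (Module.finrank ℝ (Rd d) - 1) := by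
  rcases subsingleton_or_nontrivial (Rd d) with hsub | hnt
  · have h0 : ∀ x : Rd d, radialExt k x = 0 := fun x => by
      simp [radialExt, Subsingleton.elim x 0]
    have : IsEmpty (Sph d) :=
      ⟨fun x => ne_zero_of_mem_unit_sphere x (Subsingleton.elim _ _)⟩
    simp [h0, integral_of_isEmpty]
  calc ∫ x : Rd d, a ‖x‖ * radialExt k x
      = ∫ x : ({(0)}ᶜ : Set (Rd d)), a ‖x.1‖ * radialExt k x.1
          ∂(Measure.comap Subtype.val volume) := by
        rw [integral_subtype_comap (measurableSet_singleton _).compl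
          fun x => a ‖x‖ * radialExt k x, restrict_compl_singleton]
    _ = ∫ z : Sph d × Set.Ioi (0 : ℝ), k z.1 * a z.2 ∂(sphMeasure d).prod
          (Measure.volumeIoiPow (Module.finrank ℝ (Rd d) - 1)) := by
        have h := (volume : Measure (Rd d)).measurePreserving_homeomorphUnitSphereProd.integral_comp
          (Homeomorph.measurableEmbedding _) (fun z : Sph d × Set.Ioi (0 : ℝ) => k z.1 * a z.2)
        rw [sphMeasure, ← h]
        refine integral_congr_ae (Filter.Eventually.of_forall fun x => ?_)
        have hx : (x : Rd d) ≠ 0 := x.2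
        simp only [radialExt, dif_neg hx, homeomorphUnitSphereProd_apply_snd_coe]
        rw [mul_comm]
        congr 2
        ext1
        simp
    _ = _ := integral_prod_mul k fun r : Set.Ioi (0 : ℝ) => a r

theorem integral_partialD_eq_zero {d : ℕ} (i : Fin d) {W : Rd d → ℝ} (hW : ContDiff ℝ 1 W)
    (hc : HasCompactSupport W) : ∫ x, partialD i W x = 0 := by
  have hint : Integrable (partialD i W) :=
    ((hW.continuous_fderiv one_ne_zero).clm_apply continuous_const).integrable_of_hasCompactSupport
      (hc.fderiv_apply ℝ _)
  have := integral_mul_fderiv_eq_neg_fderiv_mul_of_integrable (μ := (volume : Measure (Rd d)))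
    (f := fun _ => (1 : ℝ)) (g := W) (v := EuclideanSpace.single i 1)
    (by simp) (by simpa only [one_mul] using! hint)
    (by simpa using hW.continuous.integrable_of_hasCompactSupport hc)
    (fun x _ => differentiableAt_const _) (fun x _ => hW.differentiable one_ne_zero x)
  simpa [partialD] using this

theorem integrable_sphMeasure {d : ℕ} {f : Sph d → ℝ} (hf : Continuous f) :
    Integrable f (sphMeasure d) := by
  exact hf.integrable_of_hasCompactSupport (HasCompactSupport.of_compactSpace f)

/-- Green's formula on the sphere. -/
theorem integral_mul_sphLaplacian {d : ℕ} (hd : 1 ≤ d) {f g : Sph d → ℝ}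
    (hf : ContDiffOn ℝ 2 (radialExt f) {0}ᶜ) (hg : ContDiffOn ℝ 1 (radialExt g) {0}ᶜ) :
    ∫ x, g x * sphLaplacian f x ∂sphMeasure d =
      -∫ x, inner ℝ (sphGrad g x) (sphGrad f x) ∂sphMeasure d := by
  have h12 : (1 : WithTop ℕ∞) + 1 ≤ 2 := by norm_num [one_add_one_eq_two]
  have hP : ∀ i, ContDiffOn ℝ 1 (partialD i (radialExt f)) {0}ᶜ := fun i =>
    contDiffOn_partialD i hf h12
  let φ : ContDiffBump (1 : ℝ) := ⟨1 / 4, 1 / 2, by norm_num, by norm_num⟩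
  -- The factor `t = |x|²` compensates the degree -2 homogeneity of the divergence of `g∇f`, leaving
  -- exactly `φ(|x|²)` times a function of the direction.
  let ψ : ℝ → ℝ := fun t => t * φ t
  have hψ : ContDiff ℝ 1 ψ := contDiff_id.mul φ.contDiff
  let χ : Rd d → ℝ := fun x => ψ (‖x‖ ^ 2)
  have hχ : ContDiff ℝ 1 χ := hψ.comp (contDiff_norm_sq ℝ)
  let K : Set (Rd d) := {x | ‖x‖ ^ 2 ∈ Metric.closedBall (1 : ℝ) (1 / 2)}
  have hKclosed : IsClosed K := Metric.isClosed_closedBall.preimage (by fun_prop)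
  have hKcompact : IsCompact K := by
    refine Metric.isCompact_of_isClosed_isBounded hKclosed
      ((Metric.isBounded_closedBall (x := (0 : Rd d)) (r := 2)).subset fun x hx => ?_)
    have hx' : |‖x‖ ^ 2 - 1| ≤ 1 / 2 := hx
    rw [mem_closedBall_zero_iff]
    nlinarith [abs_le.1 hx', norm_nonneg x]
  have hK0 : K ⊆ {0}ᶜ := by
    rintro x hx rfl
    have hx' : |‖(0 : Rd d)‖ ^ 2 - 1| ≤ 1 / 2 := hx
    norm_num at hx'
  have hφK : ∀ x, x ∉ K → φ (‖x‖ ^ 2) = 0 := fun x hx =>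
    φ.zero_of_le_dist (le_of_lt (not_le.1 hx))
  let W : Fin d → Rd d → ℝ := fun i x => χ x * (radialExt g x * partialD i (radialExt f) x)
  have hWsupp : ∀ i, tsupport (W i) ⊆ K := fun i =>
    closure_minimal (fun x hx => by
      by_contra hxK
      exact hx (by simp [W, χ, ψ, hφK x hxK])) hKclosed
  have hWc : ∀ i, HasCompactSupport (W i) := fun i =>
    hKcompact.of_isClosed_subset (isClosed_tsupport _) (hWsupp i)
  have hWd : ∀ i, ContDiff ℝ 1 (W i) := fun i => contDiff_iff_contDiffAt.2 fun x => by
    by_cases hx : x ∉ tsupport (W i)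
    · exact contDiffAt_const.congr_of_eventuallyEq (notMem_tsupport_iff_eventuallyEq.1 hx)
    rw [not_not] at hx
    have hx0 := isOpen_compl_singleton.mem_nhds (hK0 (hWsupp i hx))
    exact hχ.contDiffAt.mul ((hg.contDiffAt hx0).mul ((hP i).contDiffAt hx0))
  let k : Sph d → ℝ := fun x =>
    inner ℝ (sphGrad g x) (sphGrad f x) + g x * sphLaplacian f x
  have hk : ∀ x : Rd d, x ≠ 0 → radialExt k x = ‖x‖ ^ 2 *
      (∑ i, partialD i (radialExt g) x * partialD i (radialExt f) x +
        radialExt g x * ∑ i, partialD i (partialD i (radialExt f)) x) := by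
    intro x hx
    have h := radialExt_of_ne_zero (f := k) (g := fun x =>
      ∑ i, partialD i (radialExt g) x * partialD i (radialExt f) x +
        radialExt g x * ∑ i, partialD i (partialD i (radialExt f)) x) (fun y => by
          simp only [k, inner_sphGrad, sphLaplacian_eq hf le_rfl, radialExt_coe]) hx
    rw [h]
    have hx' : 0 < ‖x‖⁻¹ := inv_pos.2 (norm_pos_iff.2 hx)
    simp only [partialD_radialExt_smul _ _ hx', partialD_partialD_radialExt_smul f _ _ hx',
      radialExt_smul g hx', inv_inv, inv_pow, mul_add, Finset.mul_sum]
    congr 1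
    · exact Finset.sum_congr rfl fun i _ => by ring
    · exact Finset.sum_congr rfl fun i _ => by ring
  have hdiv : ∀ x : Rd d, x ≠ 0 → ∑ i, partialD i (W i) x = φ (‖x‖ ^ 2) * radialExt k x := by
    intro x hx
    have hgx := hg.differentiableAt_of_ne_zero one_ne_zero hx
    have hPx : ∀ i, DifferentiableAt ℝ (partialD i (radialExt f)) x := fun i =>
      (hP i).differentiableAt_of_ne_zero one_ne_zero hx
    have hχi : ∀ i, partialD i χ x = deriv ψ (‖x‖ ^ 2) * (2 * x i) := fun i => by
      rw [← partialD_norm_sq i x]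
      exact partialD_comp i (hψ.differentiable one_ne_zero _).hasDerivAt
        (differentiableAt_norm_sq x)
    have hWi : ∀ i, partialD i (W i) x =
        2 * deriv ψ (‖x‖ ^ 2) * radialExt g x * (x i * partialD i (radialExt f) x) +
        χ x * (partialD i (radialExt g) x * partialD i (radialExt f) x +
          radialExt g x * partialD i (partialD i (radialExt f)) x) := fun i => by
      rw [partialD_mul i (hχ.differentiable one_ne_zero x) (hgx.fun_mul (hPx i)),
        partialD_mul i hgx (hPx i), hχi]
      ring
    simp_rw [hWi, Finset.sum_add_distrib, ← Finset.mul_sum, Finset.sum_add_distrib,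
      ← Finset.mul_sum]
    -- The gradient of the cutoff is radial, so Euler's identity in degree 0 kills its contribution.
    rw [sum_mul_partialD_radialExt hf one_le_two hx, hk x hx]
    simp only [χ, ψ]
    ring
  have hzero : ∫ x : Rd d, φ (‖x‖ ^ 2) * radialExt k x = 0 := by
    have hint : ∀ i, Integrable (partialD i (W i)) := fun i =>
      (((hWd i).continuous_fderiv one_ne_zero).clm_apply
        continuous_const).integrable_of_hasCompactSupport ((hWc i).fderiv_apply ℝ _)
    have hsum : ∫ x : Rd d, ∑ i, partialD i (W i) x = 0 := by
      rw [integral_finsetSum _ fun i _ => hint i]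
      exact Finset.sum_eq_zero fun i _ => integral_partialD_eq_zero i (hWd i) (hWc i)
    rw [← hsum]
    have : Nontrivial (Rd d) := by
      have : Nonempty (Fin d) := ⟨⟨0, hd⟩⟩
      infer_instance
    refine integral_congr_ae ?_
    filter_upwards [compl_mem_ae_iff.2 (measure_singleton (0 : Rd d))] with x hx
    rw [hdiv x hx]
  have hpos : 0 < ∫ x : Rd d, φ (‖x‖ ^ 2) := by
    have hcont : Continuous fun x : Rd d => φ (‖x‖ ^ 2) := φ.continuous.comp (by fun_prop)
    refine hcont.integral_pos_of_hasCompactSupport_nonneg_nonzero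
      (HasCompactSupport.intro hKcompact hφK) (fun x => φ.nonneg)
      (x := EuclideanSpace.single ⟨0, hd⟩ 1) ?_
    have : φ (1 : ℝ) = 1 := φ.one_of_mem_closedBall (by simp [φ])
    simp [this]
  -- Taking the constant 1 in place of `k` shows that the radial factor in polar coordinates is
  -- nonzero, so it can be cancelled from `hzero`.
  have hone : ∫ x : Rd d, φ (‖x‖ ^ 2) =
      ∫ x : Rd d, φ (‖x‖ ^ 2) * radialExt (fun _ => (1 : ℝ)) x := by
    refine integral_congr_ae (Filter.Eventually.of_forall fun x => ?_)
    by_cases hx : x = 0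
    · subst hx
      simp only [hφK 0 fun h => hK0 h rfl, zero_mul]
    · simp [radialExt, hx]
  rw [hone, integral_radial_mul_radialExt (fun r => φ (r ^ 2))] at hpos
  rw [integral_radial_mul_radialExt (fun r => φ (r ^ 2))] at hzero
  have hk0 : ∫ x, k x ∂sphMeasure d = 0 :=
    (mul_eq_zero.1 hzero).resolve_right (right_ne_zero_of_mul hpos.ne')
  have hi1 : Integrable (fun x => inner ℝ (sphGrad g x) (sphGrad f x)) (sphMeasure d) :=
    integrable_sphMeasure (continuous_of_contDiffOn_radialExt
      (contDiffOn_radialExt_inner_sphGrad (k := 0) hg (hf.of_le one_le_two) (by simp)))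
  have hi2 : Integrable (fun x => g x * sphLaplacian f x) (sphMeasure d) :=
    integrable_sphMeasure ((continuous_of_contDiffOn_radialExt hg).mul
      (continuous_of_contDiffOn_radialExt
        (contDiffOn_radialExt_sphLaplacian (k := 0) hf h12 (by simp) le_rfl)))
  rw [integral_add hi1 hi2] at hk0
  linarith

theorem integral_linear_combination {Ω : Type*} [MeasurableSpace Ω] {μ : Measure Ω}
    {f₁ f₂ f₃ f₄ f₅ : Ω → ℝ} (h₁ : Integrable f₁ μ) (h₂ : Integrable f₂ μ) (h₃ : Integrable f₃ μ)
    (h₄ : Integrable f₄ μ) (h₅ : Integrable f₅ μ) (c₁ c₂ c₃ c₄ c₅ : ℝ) :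
    ∫ x, (c₁ * f₁ x + c₂ * f₂ x + c₃ * f₃ x + c₄ * f₄ x + c₅ * f₅ x) ∂μ =
      c₁ * ∫ x, f₁ x ∂μ + c₂ * ∫ x, f₂ x ∂μ + c₃ * ∫ x, f₃ x ∂μ + c₄ * ∫ x, f₄ x ∂μ
        + c₅ * ∫ x, f₅ x ∂μ := by
  have k₁ := h₁.const_mul c₁
  have k₂ := h₂.const_mul c₂
  have k₃ := h₃.const_mul c₃
  have k₄ := h₄.const_mul c₄
  rw [integral_add (((k₁.fun_add k₂).fun_add k₃).fun_add k₄) (h₅.const_mul c₅),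
    integral_add ((k₁.fun_add k₂).fun_add k₃) k₄, integral_add (k₁.fun_add k₂) k₃, integral_add k₁ k₂]
  simp only [integral_const_mul]

/-! ### Signs of the coefficients. -/

theorem coeffSq_pos {d : ℕ} (hd : 3 ≤ d) {n : ℝ} (hn : (d : ℝ) < n) : 0 < coeffSq d n := by
  have hd' : (3 : ℝ) ≤ d := by exact_mod_cast hd
  exact div_pos (mul_pos (by linarith) (by linarith)) (mul_pos (by linarith) (by linarith))

theorem coeffGrad4_pos {d : ℕ} (hd : 3 ≤ d) {n : ℝ} (hn : (d : ℝ) < n) : 0 < coeffGrad4 d n := by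
  have hd' : (3 : ℝ) ≤ d := by exact_mod_cast hd
  have h1 : 0 < n - 1 := by linarith
  have h2 : 0 < n - 2 := by linarith
  have h3 : 0 < n + 1 := by linarith
  have h4 : 0 < n + 3 := by linarith
  have h5 : 0 < (d : ℝ) - 2 := by linarith
  have h6 : 0 < n - d := by linarith
  unfold coeffGrad4
  positivity

theorem alphaFS_sq {d : ℕ} (hd : 3 ≤ d) {n : ℝ} (hn : (d : ℝ) < n) :
    alphaFS d n ^ 2 = ((d : ℝ) - 1) / (n - 1) := by
  have hd' : (3 : ℝ) ≤ d := by exact_mod_cast hd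
  exact Real.sq_sqrt (div_nonneg (by linarith) (by linarith))

theorem tensorNormSq_nonneg {d : ℕ} {x : Sph d} (A : TwoTensor x) : 0 ≤ tensorNormSq A :=
  Finset.sum_nonneg fun _ _ => Finset.sum_nonneg fun _ _ => sq_nonneg _

/-! ### Integrations by parts with powers of `p` as weights. -/

section WeightedIntegrals

variable {d : ℕ} {p : Sph d → ℝ}

theorem sphGrad_rpow (hp : ContDiffOn ℝ 1 (radialExt p) {0}ᶜ) (hpos : ∀ x, 0 < p x) (s : ℝ)
    (x : Sph d) : sphGrad (fun y => p y ^ s) x = (s * p x ^ (s - 1)) • sphGrad p x :=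
  sphGrad_comp hp (Real.hasDerivAt_rpow_const (Or.inl (hpos x).ne'))

theorem continuous_hessForm_sphGrad (hp : ContDiffOn ℝ 2 (radialExt p) {0}ᶜ) :
    Continuous fun x => hessForm p x (sphGrad p x) (sphGrad p x) := by
  have h12 : (1 : WithTop ℕ∞) + 1 ≤ 2 := by norm_num [one_add_one_eq_two]
  have h := (continuous_of_contDiffOn_radialExt (contDiffOn_radialExt_inner_sphGrad (k := 0)
    (hp.of_le one_le_two) (contDiffOn_radialExt_norm_sphGrad_sq hp h12) (by simp))).const_mul
      (1 / 2 : ℝ)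
  refine h.congr fun x => ?_
  rw [inner_sphGrad_norm_sphGrad_sq hp]
  ring

/-- Green's formula for `|∇p|²` tested against `p^s`; it needs `|∇p|²` of class `C²`, hence `p` of
class `C³`. -/
theorem integral_rpow_mul_sphLaplacian_norm_sphGrad_sq (hd : 1 ≤ d)
    (hp : ContDiffOn ℝ 3 (radialExt p) {0}ᶜ) (hpos : ∀ x, 0 < p x) (s : ℝ) :
    ∫ x, p x ^ s * sphLaplacian (fun y => ‖sphGrad p y‖ ^ 2) x ∂sphMeasure d =
      -(2 * s) * ∫ x, hessForm p x (sphGrad p x) (sphGrad p x) / p x * p x ^ s ∂sphMeasure d := by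
  have h1 : ContDiffOn ℝ 1 (radialExt p) {0}ᶜ := hp.of_le (by norm_num)
  have h2 : ContDiffOn ℝ 2 (radialExt p) {0}ᶜ := hp.of_le (by norm_num)
  rw [integral_mul_sphLaplacian hd (contDiffOn_radialExt_norm_sphGrad_sq hp (by norm_num))
    (contDiffOn_radialExt_rpow h1 hpos s), ← integral_const_mul, ← integral_neg]
  congr 1
  ext x
  rw [sphGrad_rpow h1 hpos, real_inner_smul_left, inner_sphGrad_norm_sphGrad_sq h2,
    Real.rpow_sub_one (hpos x).ne']
  ring

/-- Green's formula for `p` tested against `Δp · p^s`; it eliminates the integral of `∇p·∇Δp`. -/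
theorem integral_sphLaplacian_sq_mul_rpow (hd : 1 ≤ d)
    (hp : ContDiffOn ℝ 3 (radialExt p) {0}ᶜ) (hpos : ∀ x, 0 < p x) (s : ℝ) :
    ∫ x, sphLaplacian p x ^ 2 * p x ^ s ∂sphMeasure d =
      -s * ∫ x, sphLaplacian p x * ‖sphGrad p x‖ ^ 2 / p x * p x ^ s ∂sphMeasure d
        - ∫ x, inner ℝ (sphGrad p x) (sphGrad (sphLaplacian p) x) * p x ^ s ∂sphMeasure d := by
  have h1 : ContDiffOn ℝ 1 (radialExt p) {0}ᶜ := hp.of_le (by norm_num)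
  have h2 : ContDiffOn ℝ 2 (radialExt p) {0}ᶜ := hp.of_le (by norm_num)
  have h12 : (1 : WithTop ℕ∞) + 1 ≤ 2 := by norm_num [one_add_one_eq_two]
  have hΔ : ContDiffOn ℝ 1 (radialExt (sphLaplacian p)) {0}ᶜ :=
    contDiffOn_radialExt_sphLaplacian (l := 2) hp (by norm_num) h12 (by norm_num)
  have hw := contDiffOn_radialExt_rpow h1 hpos s
  have cw : Continuous fun x => p x ^ s := continuous_of_contDiffOn_radialExt hw
  have cp : Continuous p := continuous_of_contDiffOn_radialExt h1
  have cΔ : Continuous (sphLaplacian p) := continuous_of_contDiffOn_radialExt hΔ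
  have cQ : Continuous fun x => ‖sphGrad p x‖ ^ 2 := continuous_of_contDiffOn_radialExt
    (contDiffOn_radialExt_norm_sphGrad_sq h2 h12)
  have ci : Continuous fun x => inner ℝ (sphGrad p x) (sphGrad (sphLaplacian p) x) :=
    continuous_of_contDiffOn_radialExt
      (contDiffOn_radialExt_inner_sphGrad (k := 0) h1 hΔ (by simp))
  have hG := integral_mul_sphLaplacian hd h2 (hΔ.radialExt_mul hw)
  have e : ∀ x, sphLaplacian p x ^ 2 * p x ^ s = sphLaplacian p x * p x ^ s * sphLaplacian p x :=
    fun x => by ring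
  simp_rw [e]
  rw [hG, ← integral_const_mul, ← integral_neg, ← integral_sub]
  · congr 1
    ext x
    rw [sphGrad_mul hΔ hw, sphGrad_rpow h1 hpos, inner_add_left, real_inner_smul_left,
      real_inner_smul_left, real_inner_smul_left, real_inner_self_eq_norm_sq,
      real_inner_comm (sphGrad (sphLaplacian p) x), Real.rpow_sub_one (hpos x).ne']
    ring
  · exact (integrable_sphMeasure (((cΔ.mul cQ).div cp fun x => (hpos x).ne').mul cw)).const_mul _
  · exact integrable_sphMeasure (ci.mul cw)

/-- Green's formula for `p` tested against `|∇p|² p^(s-1)`. -/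
theorem integral_sphLaplacian_mul_norm_sphGrad_sq_mul_rpow (hd : 1 ≤ d)
    (hp : ContDiffOn ℝ 2 (radialExt p) {0}ᶜ) (hpos : ∀ x, 0 < p x) (s : ℝ) :
    ∫ x, sphLaplacian p x * ‖sphGrad p x‖ ^ 2 / p x * p x ^ s ∂sphMeasure d =
      (1 - s) * ∫ x, ‖sphGrad p x‖ ^ 4 / p x ^ 2 * p x ^ s ∂sphMeasure d
        - 2 * ∫ x, hessForm p x (sphGrad p x) (sphGrad p x) / p x * p x ^ s ∂sphMeasure d := by
  have h1 : ContDiffOn ℝ 1 (radialExt p) {0}ᶜ := hp.of_le one_le_two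
  have h12 : (1 : WithTop ℕ∞) + 1 ≤ 2 := by norm_num [one_add_one_eq_two]
  have hQ := contDiffOn_radialExt_norm_sphGrad_sq hp h12
  have cw : Continuous fun x => p x ^ s :=
    continuous_of_contDiffOn_radialExt (contDiffOn_radialExt_rpow h1 hpos s)
  have cp : Continuous p := continuous_of_contDiffOn_radialExt h1
  have cQ : Continuous fun x => ‖sphGrad p x‖ ^ 2 := continuous_of_contDiffOn_radialExt hQ
  have cQ2 : Continuous fun x => ‖sphGrad p x‖ ^ 4 := (cQ.fun_pow 2).congr fun x => by ring
  have hw := contDiffOn_radialExt_rpow h1 hpos (s - 1)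
  have hG := integral_mul_sphLaplacian hd hp (hQ.radialExt_mul hw)
  have e : ∀ x, sphLaplacian p x * ‖sphGrad p x‖ ^ 2 / p x * p x ^ s =
      ‖sphGrad p x‖ ^ 2 * p x ^ (s - 1) * sphLaplacian p x := fun x => by
    rw [Real.rpow_sub_one (hpos x).ne']
    ring
  simp_rw [e]
  rw [hG, ← integral_const_mul, ← integral_const_mul, ← integral_neg, ← integral_sub]
  · congr 1
    ext x
    rw [sphGrad_mul hQ hw, sphGrad_rpow h1 hpos, inner_add_left, real_inner_smul_left,
      real_inner_smul_left, real_inner_smul_left, real_inner_self_eq_norm_sq,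
      real_inner_comm (sphGrad p x), inner_sphGrad_norm_sphGrad_sq hp,
      Real.rpow_sub_one (hpos x).ne', Real.rpow_sub_one (hpos x).ne']
    have := (hpos x).ne'
    field_simp
    ring
  · exact (integrable_sphMeasure
      ((cQ2.div (cp.pow 2) fun x => pow_ne_zero 2 (hpos x).ne').mul cw)).const_mul _
  · exact (integrable_sphMeasure (((continuous_hessForm_sphGrad hp).div cp
      fun x => (hpos x).ne').mul cw)).const_mul _

end WeightedIntegrals

end

/-! ### Assembly of the identity. -/

theorem lemma4 (d : ℕ) (hd : 3 ≤ d) (n : ℝ) (hn : (d : ℝ) < n) (α : ℝ) (p : Sph d → ℝ)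
    (hp : SphContDiff (show 1 ≤ d by omega) 3 p) (hpos : ∀ x, 0 < p x) :
    -- all the integrals that occur are convergent
    (Integrable (fun x => angularTerm n α p x * p x ^ (1 - n)) (sphMeasure d) ∧
      Integrable (fun x => tensorNormSq (tensorL p x - coeffM d n • tensorM p x) * p x ^ (1 - n))
        (sphMeasure d) ∧
      Integrable (fun x => ‖sphGrad p x‖ ^ 4 / p x ^ 2 * p x ^ (1 - n)) (sphMeasure d) ∧
      Integrable (fun x => ‖sphGrad p x‖ ^ 2 * p x ^ (1 - n)) (sphMeasure d)) ∧
    -- the identity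
    (∫ x, angularTerm n α p x * p x ^ (1 - n) ∂(sphMeasure d) =
      coeffSq d n *
          (∫ x, tensorNormSq (tensorL p x - coeffM d n • tensorM p x) * p x ^ (1 - n)
            ∂(sphMeasure d))
        + coeffGrad4 d n *
          (∫ x, ‖sphGrad p x‖ ^ 4 / p x ^ 2 * p x ^ (1 - n) ∂(sphMeasure d))
        + (n - 2) * (alphaFS d n ^ 2 - α ^ 2) *
          (∫ x, ‖sphGrad p x‖ ^ 2 * p x ^ (1 - n) ∂(sphMeasure d))) ∧
    -- the first two integrals have positive coefficients
    (0 < coeffSq d n ∧ 0 < coeffGrad4 d n) ∧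
    -- all terms are non-negative in the symmetry range
    (0 ≤ α → α ≤ alphaFS d n →
      0 ≤ coeffSq d n *
          (∫ x, tensorNormSq (tensorL p x - coeffM d n • tensorM p x) * p x ^ (1 - n)
            ∂(sphMeasure d)) ∧
      0 ≤ coeffGrad4 d n *
          (∫ x, ‖sphGrad p x‖ ^ 4 / p x ^ 2 * p x ^ (1 - n) ∂(sphMeasure d)) ∧
      0 ≤ (n - 2) * (alphaFS d n ^ 2 - α ^ 2) *
          (∫ x, ‖sphGrad p x‖ ^ 2 * p x ^ (1 - n) ∂(sphMeasure d))) := by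
  have hd' : (3 : ℝ) ≤ d := by exact_mod_cast hd
  have hd1 : 1 ≤ d := by omega
  have h3 : ContDiffOn ℝ 3 (radialExt p) {0}ᶜ := contDiffOn_radialExt hd1 hp
  have h2 : ContDiffOn ℝ 2 (radialExt p) {0}ᶜ := h3.of_le (by norm_num)
  have h1 : ContDiffOn ℝ 1 (radialExt p) {0}ᶜ := h3.of_le (by norm_num)
  have h12 : (1 : WithTop ℕ∞) + 1 ≤ 2 := by norm_num [one_add_one_eq_two]
  have hQ : ContDiffOn ℝ 2 (radialExt fun x => ‖sphGrad p x‖ ^ 2) {0}ᶜ :=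
    contDiffOn_radialExt_norm_sphGrad_sq h3 (by norm_num)
  have hΔ : ContDiffOn ℝ 1 (radialExt (sphLaplacian p)) {0}ᶜ :=
    contDiffOn_radialExt_sphLaplacian (l := 2) h3 (by norm_num) h12 (by norm_num)
  have hp0 : ∀ x, p x ≠ 0 := fun x => (hpos x).ne'
  have cp : Continuous p := continuous_of_contDiffOn_radialExt h1
  have cw : Continuous fun x => p x ^ (1 - n) :=
    continuous_of_contDiffOn_radialExt (contDiffOn_radialExt_rpow h1 hpos (1 - n))
  have cΔ : Continuous (sphLaplacian p) := continuous_of_contDiffOn_radialExt hΔ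
  have cQ : Continuous fun x => ‖sphGrad p x‖ ^ 2 := continuous_of_contDiffOn_radialExt hQ
  have cQ2 : Continuous fun x => ‖sphGrad p x‖ ^ 4 := (cQ.fun_pow 2).congr fun x => by ring
  have cΔQ : Continuous (sphLaplacian fun x => ‖sphGrad p x‖ ^ 2) :=
    continuous_of_contDiffOn_radialExt
      (contDiffOn_radialExt_sphLaplacian (k := 0) hQ h12 (by simp) le_rfl)
  have ci : Continuous fun x => inner ℝ (sphGrad p x) (sphGrad (sphLaplacian p) x) :=
    continuous_of_contDiffOn_radialExt
      (contDiffOn_radialExt_inner_sphGrad (k := 0) h1 hΔ (by simp))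
  -- The orthonormal bases in `tensorNormSq` are chosen point by point, so continuity is read off
  -- the Bochner formula instead.
  have cH : Continuous fun x => tensorNormSq (sphHess p x) := by
    refine (((cΔQ.const_mul (1 / 2)).sub ci).sub (cQ.const_mul ((d : ℝ) - 2))).congr fun x => ?_
    simp only [Pi.sub_apply]
    rw [bochner_sphere h3]
    ring
  have iH : Integrable (fun x => tensorNormSq (sphHess p x) * p x ^ (1 - n))
      (sphMeasure d) := integrable_sphMeasure (cH.mul cw)
  have iG : Integrable (fun x => ‖sphGrad p x‖ ^ 2 * p x ^ (1 - n))
      (sphMeasure d) := integrable_sphMeasure (cQ.mul cw)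
  have iL : Integrable (fun x => sphLaplacian p x ^ 2 * p x ^ (1 - n))
      (sphMeasure d) := integrable_sphMeasure ((cΔ.pow 2).mul cw)
  have iA : Integrable (fun x => hessForm p x (sphGrad p x) (sphGrad p x) / p x * p x ^ (1 - n))
      (sphMeasure d) := integrable_sphMeasure (((continuous_hessForm_sphGrad h2).div cp hp0).mul cw)
  have iB : Integrable (fun x => sphLaplacian p x * ‖sphGrad p x‖ ^ 2 / p x * p x ^ (1 - n))
      (sphMeasure d) := integrable_sphMeasure (((cΔ.mul cQ).div cp hp0).mul cw)
  have iQ : Integrable (fun x => ‖sphGrad p x‖ ^ 4 / p x ^ 2 * p x ^ (1 - n))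
      (sphMeasure d) := integrable_sphMeasure
    ((cQ2.div (cp.pow 2) fun x => pow_ne_zero 2 (hp0 x)).mul cw)
  have iΔQ : Integrable (fun x => p x ^ (1 - n) * sphLaplacian (fun y => ‖sphGrad p y‖ ^ 2) x)
      (sphMeasure d) := integrable_sphMeasure (cw.mul cΔQ)
  have iI : Integrable (fun x => inner ℝ (sphGrad p x) (sphGrad (sphLaplacian p) x) * p x ^ (1 - n))
      (sphMeasure d) := integrable_sphMeasure (ci.mul cw)
  have r1 := integral_rpow_mul_sphLaplacian_norm_sphGrad_sq hd1 h3 hpos (1 - n)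
  have r2 := integral_sphLaplacian_sq_mul_rpow hd1 h3 hpos (1 - n)
  have r3 := integral_sphLaplacian_mul_norm_sphGrad_sq_mul_rpow hd1 h2 hpos (1 - n)
  -- Integrated Bochner formula; the zero coefficients only pad the sum to five terms.
  have r4 := integral_linear_combination iΔQ iI iG iG iG (1 / 2) (-1) (-((d : ℝ) - 2)) 0 0
  have e4 : ∀ x, 1 / 2 * (p x ^ (1 - n) * sphLaplacian (fun y => ‖sphGrad p y‖ ^ 2) x) +
      -1 * (inner ℝ (sphGrad p x) (sphGrad (sphLaplacian p) x) * p x ^ (1 - n)) +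
      -((d : ℝ) - 2) * (‖sphGrad p x‖ ^ 2 * p x ^ (1 - n)) +
      0 * (‖sphGrad p x‖ ^ 2 * p x ^ (1 - n)) + 0 * (‖sphGrad p x‖ ^ 2 * p x ^ (1 - n)) =
      tensorNormSq (sphHess p x) * p x ^ (1 - n) := fun x => by
    linear_combination p x ^ (1 - n) * bochner_sphere (x := x) h3
  simp_rw [e4] at r4
  have eLHS : ∀ x, angularTerm n α p x * p x ^ (1 - n) =
      1 * (tensorNormSq (sphHess p x) * p x ^ (1 - n)) +
      (((d : ℝ) - 2) - (n - 2) * α ^ 2) * (‖sphGrad p x‖ ^ 2 * p x ^ (1 - n)) +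
      (-(1 / (n - 1))) * (sphLaplacian p x ^ 2 * p x ^ (1 - n)) +
      0 * (‖sphGrad p x‖ ^ 2 * p x ^ (1 - n)) +
      0 * (‖sphGrad p x‖ ^ 2 * p x ^ (1 - n)) := fun x => by
    rw [angularTerm, bochner_sphere h3]
    ring
  have eSq : ∀ x, tensorNormSq (tensorL p x - coeffM d n • tensorM p x) * p x ^ (1 - n) =
      1 * (tensorNormSq (sphHess p x) * p x ^ (1 - n)) +
      (-(1 / ((d : ℝ) - 1))) * (sphLaplacian p x ^ 2 * p x ^ (1 - n)) +
      (-(2 * coeffM d n)) *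
        (hessForm p x (sphGrad p x) (sphGrad p x) / p x * p x ^ (1 - n)) +
      (2 * coeffM d n / ((d : ℝ) - 1)) *
        (sphLaplacian p x * ‖sphGrad p x‖ ^ 2 / p x * p x ^ (1 - n)) +
      (coeffM d n ^ 2 * (((d : ℝ) - 2) / ((d : ℝ) - 1))) *
        (‖sphGrad p x‖ ^ 4 / p x ^ 2 * p x ^ (1 - n)) := fun x => by
    rw [tensorNormSq_sub_smul hd h2]
    have := hp0 x
    have : (d : ℝ) - 1 ≠ 0 := by linarith
    field_simp
    ring
  have iLHS : Integrable (fun x => angularTerm n α p x * p x ^ (1 - n)) (sphMeasure d) := by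
    simp_rw [eLHS]
    exact ((((iH.const_mul _).add (iG.const_mul _)).add (iL.const_mul _)).add
      (iG.const_mul _)).add (iG.const_mul _)
  have iSq : Integrable (fun x => tensorNormSq (tensorL p x - coeffM d n • tensorM p x) *
      p x ^ (1 - n)) (sphMeasure d) := by
    simp_rw [eSq]
    exact ((((iH.const_mul _).add (iL.const_mul _)).add (iA.const_mul _)).add
      (iB.const_mul _)).add (iQ.const_mul _)
  have hw : ∀ x, 0 ≤ p x ^ (1 - n) := fun x => Real.rpow_nonneg (hpos x).le _
  have hSqpos := coeffSq_pos hd hn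
  have hGrad4pos := coeffGrad4_pos hd hn
  refine ⟨⟨iLHS, iSq, iQ, iG⟩, ?_, ⟨hSqpos, hGrad4pos⟩, fun hα hα' => ⟨?_, ?_, ?_⟩⟩
  · have n1 : n - 1 ≠ 0 := by linarith
    have n2 : n - 2 ≠ 0 := by linarith
    have d1 : (d : ℝ) - 1 ≠ 0 := by linarith
    have d2 : (d : ℝ) - 2 ≠ 0 := by linarith
    have d3 : (d : ℝ) + 1 ≠ 0 := by linarith
    simp_rw [eLHS, eSq]
    rw [integral_linear_combination iH iG iL iG iG, integral_linear_combination iH iL iA iB iQ,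
      alphaFS_sq hd hn]
    simp only [coeffSq, coeffM, coeffGrad4]
    rw [r1] at r4
    generalize (∫ x, tensorNormSq (sphHess p x) * p x ^ (1 - n) ∂sphMeasure d) = H at *
    generalize (∫ x, sphLaplacian p x ^ 2 * p x ^ (1 - n) ∂sphMeasure d) = L at *
    generalize (∫ x, hessForm p x (sphGrad p x) (sphGrad p x) / p x * p x ^ (1 - n)
      ∂sphMeasure d) = A at *
    generalize (∫ x, sphLaplacian p x * ‖sphGrad p x‖ ^ 2 / p x * p x ^ (1 - n)
      ∂sphMeasure d) = B at *
    generalize (∫ x, ‖sphGrad p x‖ ^ 4 / p x ^ 2 * p x ^ (1 - n) ∂sphMeasure d) = Q at *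
    generalize (∫ x, ‖sphGrad p x‖ ^ 2 * p x ^ (1 - n) ∂sphMeasure d) = G at *
    generalize (∫ x, inner ℝ (sphGrad p x) (sphGrad (sphLaplacian p) x) * p x ^ (1 - n)
      ∂sphMeasure d) = I at *
    have hI : I = (n - 1) * B - L := by linarith
    have hB : B = n * Q - 2 * A := by linarith
    have hH : H = (n - 1) * A - (n - 1) * B + L - ((d : ℝ) - 2) * G := by
      rw [hI] at r4
      linarith
    -- `L`, `A`, `Q`, `G` are now free variables, and what is left is a rational identity in `n`,
    -- `d`, `α`.
    rw [hH, hB]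
    field_simp
    ring
  · exact mul_nonneg hSqpos.le
      (integral_nonneg fun x => mul_nonneg (tensorNormSq_nonneg _) (hw x))
  · exact mul_nonneg hGrad4pos.le
      (integral_nonneg fun x => mul_nonneg (by positivity) (hw x))
  · refine mul_nonneg (mul_nonneg (by linarith) (sub_nonneg.2 (pow_le_pow_left₀ hα hα' 2)))
      (integral_nonneg fun x => mul_nonneg (by positivity) (hw x))
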